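/- Let $\mathbf u=2^{-53}$, let $m\ge n$, and let $X\in\mathbb R^{m\times n}$ have rank $n$, with $mn\mathbf u\le\frac1{64}$ and $n(n+1)\mathbf u\le\frac1{64}$. Let $v,t_1,t_2$ be non-negative integers with $v>0$, and suppose that $X$ is a $T_1$ sparse matrix with these parameters: $X$ has $v$ (dense) columns with at most $t_1$ nonzero entries each, and each of the other columns has at most $t_2$ nonzero entries. Write $\|\cdot\|_2$ and $\|\cdot\|_F$ for the spectral and the Frobenius norm, $\sigma_n(X)$ for the smallest singular value, $\kappa_2(X)=\|X\|_2/\sigma_n(X)$, $c=\max_{i,j}|x_{ij}|$ and $\eta=c/\|X\|_2$. Suppose that $$\kappa_2(X)\le K_1:=\frac{1}{10.5\,\eta\sqrt{(m\mathbf u+(n+1)\mathbf u)(vt_1+nt_2)}} .$$ CholeskyQR applied to $A$ computes $G=A^\top A$, the upper triangular Cholesky factor $S$ of $G$ (so $G=S^\top S$), and $AS^{-1}$ by substitution in each row; it returns $[AS^{-1},S]$. CholeskyQR2 computes $[W,Y]=\mathrm{CholeskyQR}(X)$, $[Q,Z]=\mathrm{CholeskyQR}(W)$ and $R=ZY$.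 It is executed in floating-point arithmetic under the standard model: each operation $+,-,\times,/,\sqrt{\ }$ with exact result $a$ returns some $a(1+\delta)$ with $|\delta|\le\mathbf u$, and sums are evaluated in any order. Then every such execution of CholeskyQR2 on $X$ runs to completion (no Cholesky factorization meets a non-positive pivot), and the computed factors $Q\in\mathbb R^{m\times n}$ and $R\in\mathbb R^{n\times n}$ satisfy $$\|Q^\top Q-I_n\|_F\le 5.9\,\bigl(mn\mathbf u+n(n+1)\mathbf u\bigr),$$ $$\|QR-X\|_F\le\bigl(2.52\,\eta\sqrt{vt_1+nt_2}+1.34\sqrt n\bigr)\,n\sqrt n\,\mathbf u\,\|X\|_2 .$$ -/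

import Mathlib

namespace CholQR

/-- The machine precision (unit roundoff) of double precision arithmetic. -/
noncomputable def u : ℝ := 2 ^ (-53 : ℤ)

/-! ### Matrix norms, condition number, sparsity model -/

section Norms

variable {m n : ℕ}

open scoped Matrix.Norms.Frobenius in
/-- The Frobenius norm. -/
noncomputable def frobNorm (X : Matrix (Fin m) (Fin n) ℝ) : ℝ := ‖X‖

open scoped Matrix.Norms.L2Operator in
/-- The matrix 2-norm (operator norm for the Euclidean norms). -/
noncomputable def twoNorm (X : Matrix (Fin m) (Fin n) ℝ) : ℝ := ‖X‖

/-- The `n`-th greatest (that is, the smallest) singular value `σ_n(X)` of a matrix with `n`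
columns; Mathlib's sequence of singular values is decreasing and indexed from `0`. -/
noncomputable def sigmaMin (X : Matrix (Fin m) (Fin n) ℝ) : ℝ :=
  (Matrix.toEuclideanLin X).singularValues (n - 1)

/-- The condition number `κ₂(X) = ‖X‖₂ / σ_n(X)`, meaningful for `X` of full column rank. -/
noncomputable def cond (X : Matrix (Fin m) (Fin n) ℝ) : ℝ := twoNorm X / sigmaMin X

/-- `c = max |x_ij|`. -/
noncomputable def maxAbs (X : Matrix (Fin m) (Fin n) ℝ) : ℝ :=
  ⨆ p : Fin m × Fin n, |X p.1 p.2|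

/-- `η = c / ‖X‖₂`. -/
noncomputable def eta (X : Matrix (Fin m) (Fin n) ℝ) : ℝ := maxAbs X / twoNorm X

/-- Number of nonzero entries of column `j`. -/
noncomputable def colNnz (X : Matrix (Fin m) (Fin n) ℝ) (j : Fin n) : ℕ := {i : Fin m | X i j ≠ 0}.ncard

/-- `X` is a `T₁` matrix with parameters `v, t₁, t₂`: there are `v > 0` (dense) columns with at most
`t₁` nonzero entries each, and all the other columns have at most `t₂` nonzero entries each. -/
def IsT1 (X : Matrix (Fin m) (Fin n) ℝ) (v t₁ t₂ : ℕ) : Prop :=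
  0 < v ∧ ∃ D : Finset (Fin n), D.card = v ∧
    (∀ j ∈ D, colNnz X j ≤ t₁) ∧ (∀ j ∉ D, colNnz X j ≤ t₂)

/-- `K₁ = 1 / (10.5 η √((mu + (n+1)u)(v t₁ + n t₂)))`. -/
noncomputable def K1 (X : Matrix (Fin m) (Fin n) ℝ) (v t₁ t₂ : ℕ) : ℝ :=
  1 / (10.5 * eta X * √(((m : ℝ) * u + ((n : ℝ) + 1) * u) * ((v : ℝ) * t₁ + (n : ℝ) * t₂)))

end Norms

/-! ### Floating-point arithmetic: the standard model

Every elementary operation `+, -, *, /, √` with exact result `a` returns some value `a (1 + δ)`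
with `|δ| ≤ u`. Algorithms are therefore described by the relation between their input and all
the outputs that they can possibly return. -/

/-- `b` is an admissible computed value of an elementary operation whose exact result is `a`. -/
def Rd (a b : ℝ) : Prop := ∃ δ : ℝ, |δ| ≤ u ∧ b = a * (1 + δ)

/-- `FlDot x y s r`: `r` is an admissible computed value of `∑ i ∈ s, x i * y i`. The products are
rounded, and they are added with rounding in an arbitrary order (any summation tree). -/
inductive FlDot {ι : Type} [DecidableEq ι] (x y : ι → ℝ) : Finset ι → ℝ → Prop
  | empty : FlDot x y ∅ 0
  | single (i : ι) (p : ℝ) : Rd (x i * y i) p → FlDot x y {i} p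
  | add (s t : Finset ι) (p q r : ℝ) : s.Nonempty → t.Nonempty → Disjoint s t →
      FlDot x y s p → FlDot x y t q → Rd (p + q) r → FlDot x y (s ∪ t) r

/-- `FlSubDot c x y s r`: `r` is an admissible computed value of `c - ∑ i ∈ s, x i * y i`, again
evaluated in an arbitrary order. -/
inductive FlSubDot {ι : Type} [DecidableEq ι] (c : ℝ) (x y : ι → ℝ) : Finset ι → ℝ → Prop
  | init : FlSubDot c x y ∅ c
  | sub (s t : Finset ι) (p q r : ℝ) : t.Nonempty → Disjoint s t →
      FlSubDot c x y s p → FlDot x y t q → Rd (p - q) r → FlSubDot c x y (s ∪ t) r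

/-- `C` is an admissible computed value of the matrix product `A * B`. -/
def FlMul {k l p : ℕ} (A : Matrix (Fin k) (Fin l) ℝ) (B : Matrix (Fin l) (Fin p) ℝ)
    (C : Matrix (Fin k) (Fin p) ℝ) : Prop :=
  ∀ i j, FlDot (fun r => A i r) (fun r => B r j) Finset.univ (C i j)

section Cholesky

variable {m n : ℕ}

/-- The entry `R i j`, `i < j`, is computed as `(G i j - ∑_{k<i} R k i * R k j) / R i i`. -/
def CholOff (G R : Matrix (Fin n) (Fin n) ℝ) (i j : Fin n) : Prop :=
  ∃ s, FlSubDot (G i j) (fun k => R k i) (fun k => R k j) (Finset.Iio i) s ∧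
    Rd (s / R i i) (R i j)

/-- `s` is the computed pivot `G j j - ∑_{k<j} (R k j)²`. -/
def CholPivot (G R : Matrix (Fin n) (Fin n) ℝ) (j : Fin n) (s : ℝ) : Prop :=
  FlSubDot (G j j) (fun k => R k j) (fun k => R k j) (Finset.Iio j) s

/-- Column `j` of `R` is computed successfully: the entries above the diagonal are computed, the
pivot is positive, `R j j` is its computed square root, and the entries below are zero. -/
def CholCol (G R : Matrix (Fin n) (Fin n) ℝ) (j : Fin n) : Prop :=
  (∀ i < j, CholOff G R i j) ∧
  (∃ s, CholPivot G R j s ∧ 0 < s ∧ Rd (√s) (R j j)) ∧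
  (∀ i, j < i → R i j = 0)

/-- Possible outcomes of Cholesky factorization in floating-point arithmetic (it reads the upper
triangle of `G` only): it runs to completion with upper triangular factor `R`, or it breaks down
because some computed pivot is not positive. -/
inductive FlCholesky (G : Matrix (Fin n) (Fin n) ℝ) : Option (Matrix (Fin n) (Fin n) ℝ) → Prop
  | done (R : Matrix (Fin n) (Fin n) ℝ) : (∀ j, CholCol G R j) → FlCholesky G (some R)
  | breakdown (R : Matrix (Fin n) (Fin n) ℝ) (j : Fin n) (s : ℝ) :
      (∀ k < j, CholCol G R k) → (∀ i < j, CholOff G R i j) → CholPivot G R j s → s ≤ 0 →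
      FlCholesky G none

/-- `Q` is an admissible computed value of `X R⁻¹`, `R` upper triangular: each row of `Q R = X` is
solved by substitution, `Q i j = (X i j - ∑_{k<j} Q i k * R k j) / R j j`. -/
def FlTriSolve (X : Matrix (Fin m) (Fin n) ℝ) (R : Matrix (Fin n) (Fin n) ℝ)
    (Q : Matrix (Fin m) (Fin n) ℝ) : Prop :=
  ∀ i j, ∃ s, FlSubDot (X i j) (fun k => Q i k) (fun k => R k j) (Finset.Iio j) s ∧
    Rd (s / R j j) (Q i j)

/-- Possible outcomes of CholeskyQR in floating-point arithmetic:
`G = XᵀX`, `R = Cholesky(G)`, `Q = X R⁻¹`; the outcome is `(Q, R)`, or `none` on breakdown. -/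
inductive FlCholeskyQR (X : Matrix (Fin m) (Fin n) ℝ) :
    Option (Matrix (Fin m) (Fin n) ℝ × Matrix (Fin n) (Fin n) ℝ) → Prop
  | done (G R : Matrix (Fin n) (Fin n) ℝ) (Q : Matrix (Fin m) (Fin n) ℝ) :
      FlMul X.transpose X G → FlCholesky G (some R) → FlTriSolve X R Q →
      FlCholeskyQR X (some (Q, R))
  | breakdown (G : Matrix (Fin n) (Fin n) ℝ) :
      FlMul X.transpose X G → FlCholesky G none → FlCholeskyQR X none

/-- Possible outcomes of CholeskyQR2 in floating-point arithmetic: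
`[W, Y] = CholeskyQR(X)`, `[Q, Z] = CholeskyQR(W)`, `R = Z Y`; the outcome is `(Q, R)`, or `none`
if one of the two Cholesky factorizations breaks down. -/
inductive FlCholeskyQR2 (X : Matrix (Fin m) (Fin n) ℝ) :
    Option (Matrix (Fin m) (Fin n) ℝ × Matrix (Fin n) (Fin n) ℝ) → Prop
  | done (W Q : Matrix (Fin m) (Fin n) ℝ) (Y Z R : Matrix (Fin n) (Fin n) ℝ) :
      FlCholeskyQR X (some (W, Y)) → FlCholeskyQR W (some (Q, Z)) → FlMul Z Y R →
      FlCholeskyQR2 X (some (Q, R))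
  | breakdown₁ : FlCholeskyQR X none → FlCholeskyQR2 X none
  | breakdown₂ (W : Matrix (Fin m) (Fin n) ℝ) (Y : Matrix (Fin n) (Fin n) ℝ) :
      FlCholeskyQR X (some (W, Y)) → FlCholeskyQR W none → FlCholeskyQR2 X none

end Cholesky

end CholQR

/-! Sparsity enters only through `‖X‖_F² ≤ c² (v t₁ + n t₂)`. This turns the bound on `κ₂(X)` into
`10.5² (m u + (n+1) u) ‖X‖_F² ≤ σ_n(X)²`: the errors made in forming and factoring the Gram matrix
are small against its least eigenvalue.

Roundings are tracked as factors between `(1-u)^k` and `(1-u)^(-k)`. This class is closed under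
products and inverses, so the order of summation does not matter. One CholeskyQR step on `A` then
satisfies `SᵀS = AᵀA + E` and `QS = A + F`, where `‖E‖_F` is a small multiple of `(m+n+1) u ‖A‖_F²`
and `‖F‖_F ≤ gam n ‖Q‖_F ‖S‖_F` (`FlCholeskyQR.exists_some`). A non-positive pivot is impossible: it
would put `AᵀA` close to a singular Gram matrix `PᵀP`, and testing on a kernel vector of `P`
contradicts the lower bound on `‖Ax‖` (`not_breakdown`).

The exact quotient `P = A S⁻¹` has `PᵀP - 1 = -S⁻ᵀ E S⁻¹`, hence nearly orthonormal columns, and the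
computed `Q` differs from it by `F S⁻¹` (`cholQR_orthogonality`). For `A = X` this only gives `‖WᵀW
- 1‖_F ≤ 0.04`, but then `W` is well conditioned, so the second step loses orthogonality only at the
level of rounding errors. The residual splits as `QR - X = Q(R - ZY) + (QZ - W)Y + (WY - X)`, one
backward error per term. -/

namespace CholQR

/-! ### Frobenius and spectral norms, smallest singular value, sparsity -/

section NormLemmas

variable {m n k : ℕ}

open scoped Matrix

theorem frobNorm_nonneg (A : Matrix (Fin m) (Fin n) ℝ) : 0 ≤ frobNorm A := by
  unfold frobNorm; exact @norm_nonneg _ (Matrix.frobeniusNormedAddCommGroup.toSeminormedAddCommGroup.toSeminormedAddGroup) A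

open scoped Matrix.Norms.Frobenius in
theorem frobNorm_sq (A : Matrix (Fin m) (Fin n) ℝ) : frobNorm A ^ 2 = ∑ i, ∑ j, A i j ^ 2 := by
  unfold frobNorm
  rw [Matrix.frobenius_norm_def, ← Real.sqrt_eq_rpow, Real.sq_sqrt (by positivity)]
  simp

open scoped Matrix.Norms.Frobenius in
theorem frobNorm_add_le (A B : Matrix (Fin m) (Fin n) ℝ) :
    frobNorm (A + B) ≤ frobNorm A + frobNorm B := norm_add_le A B

open scoped Matrix.Norms.Frobenius in
theorem frobNorm_transpose (A : Matrix (Fin m) (Fin n) ℝ) : frobNorm Aᵀ = frobNorm A :=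
  Matrix.frobenius_norm_transpose A

open scoped Matrix.Norms.Frobenius in
theorem frobNorm_sub_comm (A B : Matrix (Fin m) (Fin n) ℝ) :
    frobNorm (A - B) = frobNorm (B - A) := norm_sub_rev A B

open scoped Matrix.Norms.Frobenius in
theorem frobNorm_mul_le (A : Matrix (Fin m) (Fin n) ℝ) (B : Matrix (Fin n) (Fin k) ℝ) :
    frobNorm (A * B) ≤ frobNorm A * frobNorm B := Matrix.frobenius_norm_mul A B

open scoped Matrix.Norms.Frobenius in
theorem frobNorm_smul (c : ℝ) (A : Matrix (Fin m) (Fin n) ℝ) :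
    frobNorm (c • A) = |c| * frobNorm A := norm_smul c A

theorem frobNorm_mono {A B : Matrix (Fin m) (Fin n) ℝ} (h : ∀ i j, |A i j| ≤ B i j) :
    frobNorm A ≤ frobNorm B := by
  apply le_of_sq_le_sq _ (frobNorm_nonneg B)
  rw [frobNorm_sq, frobNorm_sq]
  refine Finset.sum_le_sum fun i _ => Finset.sum_le_sum fun j _ => ?_
  exact sq_le_sq' (by have := (abs_le.1 (h i j)).1; linarith) (le_of_abs_le (h i j))

theorem frobNorm_map_abs (A : Matrix (Fin m) (Fin n) ℝ) : frobNorm (A.map abs) = frobNorm A := by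
  rw [← sq_eq_sq₀ (frobNorm_nonneg _) (frobNorm_nonneg _), frobNorm_sq, frobNorm_sq]
  simp

theorem frobNorm_one_sq : frobNorm (1 : Matrix (Fin n) (Fin n) ℝ) ^ 2 = n := by
  rw [frobNorm_sq]
  simp [Matrix.one_apply]

theorem twoNorm_nonneg (A : Matrix (Fin m) (Fin n) ℝ) : 0 ≤ twoNorm A := by
  unfold twoNorm; exact @norm_nonneg _ (Matrix.instL2OpNormedAddCommGroup.toSeminormedAddCommGroup.toSeminormedAddGroup) A

theorem dotProduct_self_eq_norm_sq (x : Fin n → ℝ) : x ⬝ᵥ x = ‖WithLp.toLp 2 x‖ ^ 2 := by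
  rw [EuclideanSpace.norm_sq_eq]
  simp [dotProduct, pow_two]

open scoped Matrix.Norms.L2Operator in
theorem dotProduct_mulVec_self_le (A : Matrix (Fin m) (Fin n) ℝ) (x : Fin n → ℝ) :
    (A *ᵥ x) ⬝ᵥ (A *ᵥ x) ≤ twoNorm A ^ 2 * (x ⬝ᵥ x) := by
  rw [dotProduct_self_eq_norm_sq, dotProduct_self_eq_norm_sq, ← mul_pow]
  exact pow_le_pow_left₀ (norm_nonneg _) (Matrix.l2_opNorm_mulVec A (WithLp.toLp 2 x)) 2

open scoped Matrix.Norms.L2Operator in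
theorem twoNorm_le {A : Matrix (Fin m) (Fin n) ℝ} {C : ℝ} (hC : 0 ≤ C)
    (h : ∀ x : Fin n → ℝ, (A *ᵥ x) ⬝ᵥ (A *ᵥ x) ≤ C ^ 2 * (x ⬝ᵥ x)) : twoNorm A ≤ C := by
  unfold twoNorm
  rw [Matrix.l2_opNorm_def]
  refine ContinuousLinearMap.opNorm_le_bound _ hC fun x => ?_
  refine le_of_sq_le_sq ?_ (by positivity)
  have := h x.ofLp
  rw [dotProduct_self_eq_norm_sq, dotProduct_self_eq_norm_sq, ← mul_pow] at this
  exact this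

open scoped Matrix.Norms.L2Operator in
theorem twoNorm_transpose (A : Matrix (Fin m) (Fin n) ℝ) : twoNorm Aᵀ = twoNorm A := by
  have := Matrix.l2_opNorm_conjTranspose A
  rwa [Matrix.conjTranspose_eq_transpose_of_trivial] at this

open scoped Matrix.Norms.L2Operator in
theorem twoNorm_add_le (A B : Matrix (Fin m) (Fin n) ℝ) :
    twoNorm (A + B) ≤ twoNorm A + twoNorm B := norm_add_le A B

theorem frobNorm_sq_eq_sum_col (A : Matrix (Fin m) (Fin n) ℝ) :
    frobNorm A ^ 2 = ∑ j, A.col j ⬝ᵥ A.col j := by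
  rw [frobNorm_sq, Finset.sum_comm]
  simp [dotProduct, pow_two, Matrix.col]

theorem frobNorm_mul_le_twoNorm_left (A : Matrix (Fin m) (Fin n) ℝ) (B : Matrix (Fin n) (Fin k) ℝ) :
    frobNorm (A * B) ≤ twoNorm A * frobNorm B := by
  refine le_of_sq_le_sq ?_ (mul_nonneg (twoNorm_nonneg A) (frobNorm_nonneg B))
  rw [mul_pow, frobNorm_sq_eq_sum_col, frobNorm_sq_eq_sum_col, Finset.mul_sum]
  refine Finset.sum_le_sum fun j _ => ?_
  exact dotProduct_mulVec_self_le A (B.col j)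

theorem frobNorm_mul_le_twoNorm_right (A : Matrix (Fin m) (Fin n) ℝ)
    (B : Matrix (Fin n) (Fin k) ℝ) : frobNorm (A * B) ≤ frobNorm A * twoNorm B := by
  have := frobNorm_mul_le_twoNorm_left Bᵀ Aᵀ
  rwa [← Matrix.transpose_mul, frobNorm_transpose, frobNorm_transpose, twoNorm_transpose,
    mul_comm] at this

theorem dotProduct_sq_le (x y : Fin n → ℝ) : (x ⬝ᵥ y) ^ 2 ≤ (x ⬝ᵥ x) * (y ⬝ᵥ y) := by
  have := Finset.sum_mul_sq_le_sq_mul_sq Finset.univ x y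
  simpa [dotProduct, pow_two] using this

theorem twoNorm_le_frobNorm (A : Matrix (Fin m) (Fin n) ℝ) : twoNorm A ≤ frobNorm A := by
  refine twoNorm_le (frobNorm_nonneg A) fun x => ?_
  rw [frobNorm_sq, Finset.sum_mul]
  refine Finset.sum_le_sum fun i _ => ?_
  have := dotProduct_sq_le (A i) x
  simpa [dotProduct, pow_two, Matrix.mulVec] using this

theorem frobNorm_le_sqrt_mul_twoNorm (A : Matrix (Fin m) (Fin n) ℝ) :
    frobNorm A ≤ √n * twoNorm A := by
  have := frobNorm_mul_le_twoNorm_left A (1 : Matrix (Fin n) (Fin n) ℝ)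
  rw [Matrix.mul_one] at this
  rw [mul_comm]
  convert this
  rw [← frobNorm_one_sq, Real.sqrt_sq (frobNorm_nonneg _)]

theorem abs_dotProduct_mulVec_le (E : Matrix (Fin n) (Fin n) ℝ) (x : Fin n → ℝ) :
    |x ⬝ᵥ (E *ᵥ x)| ≤ frobNorm E * (x ⬝ᵥ x) := by
  have hx : 0 ≤ x ⬝ᵥ x := by rw [dotProduct_self_eq_norm_sq]; positivity
  refine abs_le_of_sq_le_sq ?_ (mul_nonneg (frobNorm_nonneg E) hx)
  calc _ ≤ _ := dotProduct_sq_le _ _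
    _ ≤ (x ⬝ᵥ x) * (twoNorm E ^ 2 * (x ⬝ᵥ x)) :=
        mul_le_mul_of_nonneg_left (dotProduct_mulVec_self_le E x) hx
    _ ≤ (x ⬝ᵥ x) * (frobNorm E ^ 2 * (x ⬝ᵥ x)) := by
        gcongr
        · exact twoNorm_nonneg E
        · exact twoNorm_le_frobNorm E
    _ = _ := by ring

theorem dotProduct_mulVec_gram (A : Matrix (Fin m) (Fin n) ℝ) (x : Fin n → ℝ) :
    x ⬝ᵥ ((Aᵀ * A) *ᵥ x) = (A *ᵥ x) ⬝ᵥ (A *ᵥ x) := by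
  rw [← Matrix.mulVec_mulVec, Matrix.dotProduct_mulVec, Matrix.vecMul_transpose]

/-- Expand `x` in an orthonormal eigenbasis of `XᵀX`; the eigenvalues decrease, and the last one is
the square of the last singular value. -/
theorem sigmaMin_sq_mul_le (hn : 0 < n) (X : Matrix (Fin m) (Fin n) ℝ) (x : Fin n → ℝ) :
    sigmaMin X ^ 2 * (x ⬝ᵥ x) ≤ (X *ᵥ x) ⬝ᵥ (X *ᵥ x) := by
  set T := Matrix.toEuclideanLin X with hT
  have hdim : Module.finrank ℝ (EuclideanSpace ℝ (Fin n)) = n := by simp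
  have hsym := T.isSymmetric_adjoint_comp_self
  set y : EuclideanSpace ℝ (Fin n) := WithLp.toLp 2 x
  set b := hsym.eigenvectorBasis hdim
  have h1 : (X *ᵥ x) ⬝ᵥ (X *ᵥ x) = inner ℝ ((LinearMap.adjoint T ∘ₗ T) y) y := by
    rw [dotProduct_self_eq_norm_sq, LinearMap.comp_apply, LinearMap.adjoint_inner_left,
      real_inner_self_eq_norm_sq]
    rfl
  have h2 : inner ℝ ((LinearMap.adjoint T ∘ₗ T) y) y
      = ∑ i, hsym.eigenvalues hdim i * (inner ℝ (b i) y) ^ 2 := by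
    rw [← b.sum_inner_mul_inner]
    refine Finset.sum_congr rfl fun i _ => ?_
    rw [hsym, hsym.apply_eigenvectorBasis, inner_smul_right, real_inner_comm y]
    simp only [RCLike.ofReal_real_eq_id, id_eq]
    ring
  have h3 : x ⬝ᵥ x = ∑ i, (inner ℝ (b i) y) ^ 2 := by
    rw [dotProduct_self_eq_norm_sq, ← real_inner_self_eq_norm_sq, ← b.sum_inner_mul_inner]
    refine Finset.sum_congr rfl fun i _ => ?_
    rw [real_inner_comm y, pow_two]
  rw [h1, h2, h3, Finset.mul_sum]
  refine Finset.sum_le_sum fun i _ => mul_le_mul_of_nonneg_right ?_ (sq_nonneg _)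
  have h4 : sigmaMin X ^ 2 = hsym.eigenvalues hdim ⟨n - 1, by omega⟩ :=
    T.sq_singularValues_of_lt hdim (i := n - 1) (by omega)
  rw [h4]
  exact hsym.eigenvalues_antitone hdim (Fin.mk_le_mk.2 (by omega) : i ≤ ⟨n - 1, by omega⟩)

theorem sigmaMin_pos (hn : 0 < n) {X : Matrix (Fin m) (Fin n) ℝ} (h : X.rank = n) :
    0 < sigmaMin X := by
  unfold sigmaMin
  rw [LinearMap.singularValues_pos_iff_lt_finrank_range]
  have : Module.finrank ℝ (Matrix.toEuclideanLin X).range = X.rank := by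
    rw [Matrix.rank_eq_finrank_range_toLin X (EuclideanSpace.basisFun (Fin m) ℝ).toBasis (EuclideanSpace.basisFun (Fin n) ℝ).toBasis, Matrix.toEuclideanLin_eq_toLin_orthonormal]
  omega

theorem sigmaMin_le_twoNorm (hn : 0 < n) (X : Matrix (Fin m) (Fin n) ℝ) :
    sigmaMin X ≤ twoNorm X := by
  refine le_of_sq_le_sq ?_ (twoNorm_nonneg X)
  have h1 := sigmaMin_sq_mul_le hn X (Pi.single ⟨0, hn⟩ 1)
  have h2 := dotProduct_mulVec_self_le X (Pi.single ⟨0, hn⟩ 1)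
  simp only [dotProduct_single, Pi.single_eq_same, mul_one] at h1 h2
  exact h1.trans h2

theorem abs_le_maxAbs (X : Matrix (Fin m) (Fin n) ℝ) (i : Fin m) (j : Fin n) :
    |X i j| ≤ maxAbs X :=
  le_ciSup (f := fun p : Fin m × Fin n => |X p.1 p.2|) (Set.finite_range _).bddAbove (i, j)

theorem col_sq_le (X : Matrix (Fin m) (Fin n) ℝ) (j : Fin n) :
    ∑ i, X i j ^ 2 ≤ colNnz X j * maxAbs X ^ 2 := by
  classical
  have h : colNnz X j = (Finset.univ.filter fun i => X i j ≠ 0).card := by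
    unfold colNnz
    rw [← Set.ncard_coe_finset]
    simp
  rw [h, ← nsmul_eq_mul, ← Finset.sum_const, Finset.sum_filter]
  refine Finset.sum_le_sum fun i _ => ?_
  split_ifs with hi
  · rw [← sq_abs]
    exact pow_le_pow_left₀ (abs_nonneg _) (abs_le_maxAbs X i j) 2
  · simp [not_not.1 hi]

/-- Count nonzero entries, each at most `c` in absolute value. A dense column is charged `t₁ + t₂`
and any other column `t₂`, which produces `n t₂` in place of `(n - v) t₂`. -/
theorem IsT1.frobNorm_sq_le {X : Matrix (Fin m) (Fin n) ℝ} {v t₁ t₂ : ℕ} (h : IsT1 X v t₁ t₂) :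
    frobNorm X ^ 2 ≤ maxAbs X ^ 2 * ((v : ℝ) * t₁ + (n : ℝ) * t₂) := by
  classical
  obtain ⟨-, D, hD, h1, h2⟩ := h
  have hj : ∀ j, (colNnz X j : ℝ) ≤ (if j ∈ D then (t₁ : ℝ) else 0) + t₂ := by
    intro j
    split_ifs with hj
    · have : (colNnz X j : ℝ) ≤ t₁ := by exact_mod_cast h1 j hj
      have : (0 : ℝ) ≤ t₂ := by positivity
      linarith
    · have : (colNnz X j : ℝ) ≤ t₂ := by exact_mod_cast h2 j hj
      linarith
  rw [frobNorm_sq, Finset.sum_comm]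
  calc _ ≤ ∑ j, ((if j ∈ D then (t₁ : ℝ) else 0) + t₂) * maxAbs X ^ 2 :=
        Finset.sum_le_sum fun j _ => (col_sq_le X j).trans
          (mul_le_mul_of_nonneg_right (hj j) (sq_nonneg _))
    _ = _ := by
        rw [← Finset.sum_mul, Finset.sum_add_distrib]
        simp [hD]
        ring

end NormLemmas

end CholQR

namespace CholQR

/-! ### Accumulated rounding factors and inner products in any order -/

section Rounding

theorem u_pos : 0 < u := by unfold u; positivity

theorem u_lt_one : u < 1 := by unfold u; norm_num [zpow_neg]

/-- `IsRdFactor k a`: the number `a` lies in the range of products of `k` factors, each of which is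
a rounding factor `1 + δ`, `|δ| ≤ u`, or the inverse of one. -/
def IsRdFactor (k : ℕ) (a : ℝ) : Prop := (1 - u) ^ k ≤ a ∧ a ≤ ((1 - u) ^ k)⁻¹

/-- The accumulated relative error of `k` roundings. -/
noncomputable def gam (k : ℕ) : ℝ := ((1 - u) ^ k)⁻¹ - 1

theorem one_sub_u_pow_pos (k : ℕ) : 0 < (1 - u) ^ k := pow_pos (sub_pos.2 u_lt_one) k

theorem IsRdFactor.pos {k : ℕ} {a : ℝ} (h : IsRdFactor k a) : 0 < a :=
  (one_sub_u_pow_pos k).trans_le h.1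

theorem IsRdFactor.one (k : ℕ) : IsRdFactor k 1 := by
  have h : (1 - u) ^ k ≤ 1 := pow_le_one₀ (sub_pos.2 u_lt_one).le (by linarith [u_pos])
  exact ⟨h, (one_le_inv₀ (one_sub_u_pow_pos k)).2 h⟩

theorem IsRdFactor.mul {k l : ℕ} {a b : ℝ} (ha : IsRdFactor k a) (hb : IsRdFactor l b) :
    IsRdFactor (k + l) (a * b) := by
  constructor
  · rw [pow_add]
    exact mul_le_mul ha.1 hb.1 (one_sub_u_pow_pos l).le ha.pos.le
  · rw [pow_add, mul_inv]
    exact mul_le_mul ha.2 hb.2 hb.pos.le (inv_nonneg.2 (one_sub_u_pow_pos k).le)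

theorem IsRdFactor.inv {k : ℕ} {a : ℝ} (ha : IsRdFactor k a) : IsRdFactor k a⁻¹ := by
  constructor
  · rw [← inv_inv ((1 - u) ^ k)]
    exact inv_anti₀ ha.pos ha.2
  · exact inv_anti₀ (one_sub_u_pow_pos k) ha.1

theorem IsRdFactor.mono {k l : ℕ} {a : ℝ} (ha : IsRdFactor k a) (h : k ≤ l) : IsRdFactor l a := by
  obtain ⟨d, rfl⟩ := Nat.exists_eq_add_of_le h
  simpa using ha.mul (IsRdFactor.one d)

theorem isRdFactor_one_add {δ : ℝ} (h : |δ| ≤ u) : IsRdFactor 1 (1 + δ) := by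
  have h0 : 0 < 1 - u := sub_pos.2 u_lt_one
  obtain ⟨h1, h2⟩ := abs_le.1 h
  refine ⟨by linarith, ?_⟩
  rw [pow_one, ← one_div, le_div_iff₀ h0]
  nlinarith [u_pos]

theorem Rd.exists_factor {a b : ℝ} (h : Rd a b) : ∃ f, IsRdFactor 1 f ∧ b = a * f := by
  obtain ⟨δ, hδ, rfl⟩ := h
  exact ⟨1 + δ, isRdFactor_one_add hδ, rfl⟩

theorem gam_nonneg (k : ℕ) : 0 ≤ gam k := sub_nonneg.2 ((IsRdFactor.one k).2)

theorem gam_mono {k l : ℕ} (h : k ≤ l) : gam k ≤ gam l := by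
  have : ((1 - u) ^ k)⁻¹ ≤ ((1 - u) ^ l)⁻¹ := by
    refine inv_anti₀ (one_sub_u_pow_pos l) ?_
    exact pow_le_pow_of_le_one (sub_pos.2 u_lt_one).le (by linarith [u_pos]) h
  unfold gam
  linarith

/-- The upper side is the definition of `gam`; the lower side is no worse because `q + q⁻¹ ≥ 2` for
`q = (1-u)^k`. -/
theorem IsRdFactor.abs_sub_one_le {k : ℕ} {a : ℝ} (h : IsRdFactor k a) : |a - 1| ≤ gam k := by
  have h0 := one_sub_u_pow_pos k
  have h1 : 2 - (1 - u) ^ k ≤ ((1 - u) ^ k)⁻¹ := by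
    rw [← sub_nonneg]
    have : ((1 - u) ^ k)⁻¹ - (2 - (1 - u) ^ k) = ((1 - u) ^ k)⁻¹ * ((1 - u) ^ k - 1) ^ 2 := by
      field_simp
      ring
    rw [this]
    positivity
  unfold gam
  rw [abs_le]
  constructor <;> linarith [h.1, h.2]

theorem gam_le {k : ℕ} (h : (k : ℝ) * u ≤ 1 / 64) : gam k ≤ 64 / 63 * (k * u) := by
  have h1 : 1 - k * u ≤ (1 - u) ^ k := by
    have := one_add_mul_le_pow (a := -u) (by linarith [u_lt_one]) k
    rw [← sub_eq_add_neg] at this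
    linarith
  have h2 : ((1 - u) ^ k)⁻¹ ≤ (1 - k * u)⁻¹ := inv_anti₀ (by linarith) h1
  have h3 : (1 - k * u)⁻¹ ≤ 1 + 64 / 63 * (k * u) := by
    have : (0 : ℝ) ≤ k * u := mul_nonneg (Nat.cast_nonneg k) u_pos.le
    rw [inv_le_iff_one_le_mul₀ (by linarith)]
    nlinarith
  unfold gam
  linarith

variable {ι : Type} [DecidableEq ι]

/-- A summation tree with `k` leaves has depth at most `k - 1`; with the rounding of the product,
each term meets at most `k` roundings, whatever the shape of the tree. -/
theorem FlDot.exists_factors {x y : ι → ℝ} {s : Finset ι} {r : ℝ} (h : FlDot x y s r) :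
    ∃ b : ι → ℝ, (∀ i ∈ s, IsRdFactor s.card (b i)) ∧ r = ∑ i ∈ s, x i * y i * b i := by
  induction h with
  | empty => exact ⟨fun _ => 1, by simp⟩
  | single i p hp =>
    obtain ⟨f, hf, rfl⟩ := hp.exists_factor
    exact ⟨fun _ => f, by simpa using hf, by simp⟩
  | add s t p q r hs ht hst _ _ hr ihs iht =>
    obtain ⟨b, hb, rfl⟩ := ihs
    obtain ⟨c, hc, rfl⟩ := iht
    obtain ⟨f, hf, rfl⟩ := hr.exists_factor
    have hs' := hs.card_pos
    have ht' := ht.card_pos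
    refine ⟨fun i => (if i ∈ s then b i else c i) * f, ?_, ?_⟩
    · intro i hi
      rw [Finset.card_union_of_disjoint hst]
      dsimp only
      split_ifs with his
      · exact ((hb i his).mul hf).mono (by omega)
      · exact ((hc i ((Finset.mem_union.1 hi).resolve_left his)).mul hf).mono (by omega)
    · rw [Finset.sum_union hst, add_mul, Finset.sum_mul, Finset.sum_mul]
      congr 1
      · refine Finset.sum_congr rfl fun i hi => ?_
        simp only [hi, if_true]
        ring
      · refine Finset.sum_congr rfl fun i hi => ?_
        simp only [Finset.disjoint_right.1 hst hi, if_false]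
        ring

theorem FlDot.abs_sub_le {x y : ι → ℝ} {s : Finset ι} {r : ℝ} (h : FlDot x y s r) :
    |r - ∑ i ∈ s, x i * y i| ≤ gam s.card * ∑ i ∈ s, |x i| * |y i| := by
  obtain ⟨b, hb, rfl⟩ := h.exists_factors
  rw [← Finset.sum_sub_distrib, Finset.mul_sum]
  refine (Finset.abs_sum_le_sum_abs _ _).trans (Finset.sum_le_sum fun i hi => ?_)
  have : x i * y i * b i - x i * y i = (b i - 1) * (x i * y i) := by ring
  rw [this, abs_mul, abs_mul]
  exact mul_le_mul_of_nonneg_right (hb i hi).abs_sub_one_le (by positivity)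

/-- Solving for `c` moves every rounding onto the computed remainder and the products. The error is
thus relative to quantities of the computed factorization, and cancellation in the subtraction does
no harm. -/
theorem FlSubDot.exists_factors {c : ℝ} {x y : ι → ℝ} {s : Finset ι} {r : ℝ}
    (h : FlSubDot c x y s r) :
    ∃ (a : ℝ) (b : ι → ℝ), IsRdFactor s.card a ∧ (∀ i ∈ s, IsRdFactor s.card (b i)) ∧
      c = r * a + ∑ i ∈ s, x i * y i * b i := by
  induction h with
  | init => exact ⟨1, fun _ => 1, IsRdFactor.one _, by simp⟩
  | sub s t p q r ht hst _ hq hr ihs =>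
    obtain ⟨a, b, ha, hb, hc⟩ := ihs
    obtain ⟨d, hd, rfl⟩ := hq.exists_factors
    obtain ⟨f, hf, rfl⟩ := hr.exists_factor
    have ht' := ht.card_pos
    have hf0 := hf.pos.ne'
    refine ⟨f⁻¹ * a, fun i => if i ∈ s then b i else a * d i, ?_, ?_, ?_⟩
    · rw [Finset.card_union_of_disjoint hst]
      exact (hf.inv.mul ha).mono (by omega)
    · intro i hi
      rw [Finset.card_union_of_disjoint hst]
      dsimp only
      split_ifs with his
      · exact (hb i his).mono (by omega)
      · exact ha.mul (hd i ((Finset.mem_union.1 hi).resolve_left his))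
    · rw [Finset.sum_union hst]
      have h1 : ∑ i ∈ s, x i * y i * (if i ∈ s then b i else a * d i)
          = ∑ i ∈ s, x i * y i * b i :=
        Finset.sum_congr rfl fun i hi => by simp only [hi, if_true]
      have h2 : ∑ i ∈ t, x i * y i * (if i ∈ s then b i else a * d i)
          = a * ∑ i ∈ t, x i * y i * d i := by
        rw [Finset.mul_sum]
        refine Finset.sum_congr rfl fun i hi => ?_
        simp only [Finset.disjoint_right.1 hst hi, if_false]
        ring
      rw [h1, h2, hc]
      field_simp
      ring

/-- Backward error of a computed value `r` of `c - ∑ i ∈ s, x i * y i`, where the remainder `r` is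
split as `z = r * f` with at most `k` further roundings. -/
theorem FlSubDot.abs_sub_le {c : ℝ} {x y : ι → ℝ} {s : Finset ι} {r : ℝ}
    (h : FlSubDot c x y s r) {z f : ℝ} {k : ℕ} (hf : IsRdFactor k f) (hz : z = r * f) :
    |z + ∑ i ∈ s, x i * y i - c| ≤ gam (s.card + k) * (|z| + ∑ i ∈ s, |x i| * |y i|) := by
  obtain ⟨a, b, ha, hb, hc⟩ := h.exists_factors
  have hr : r * a = z * (a * f⁻¹) := by
    rw [hz]
    field_simp [hf.pos.ne']
  have h1 : z + ∑ i ∈ s, x i * y i - c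
      = (1 - a * f⁻¹) * z + ∑ i ∈ s, (1 - b i) * (x i * y i) := by
    rw [hc, hr]
    simp only [sub_mul, one_mul, Finset.sum_sub_distrib]
    have : ∑ i ∈ s, b i * (x i * y i) = ∑ i ∈ s, x i * y i * b i :=
      Finset.sum_congr rfl fun i _ => by ring
    rw [this]
    ring
  rw [h1, mul_add, Finset.mul_sum]
  refine (abs_add_le _ _).trans (add_le_add ?_ ?_)
  · rw [abs_mul, abs_sub_comm]
    exact mul_le_mul_of_nonneg_right (ha.mul hf.inv).abs_sub_one_le (abs_nonneg z)
  · refine (Finset.abs_sum_le_sum_abs _ _).trans (Finset.sum_le_sum fun i hi => ?_)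
    rw [abs_mul, abs_mul, abs_sub_comm]
    exact mul_le_mul_of_nonneg_right (((hb i hi).mono (Nat.le_add_right _ k)).abs_sub_one_le)
      (by positivity)

variable {k l p : ℕ}

open scoped Matrix in
theorem FlMul.abs_sub_le {A : Matrix (Fin k) (Fin l) ℝ} {B : Matrix (Fin l) (Fin p) ℝ}
    {C : Matrix (Fin k) (Fin p) ℝ} (h : FlMul A B C) (i : Fin k) (j : Fin p) :
    |C i j - (A * B) i j| ≤ gam l * (A.map abs * B.map abs) i j := by
  simpa [Matrix.mul_apply] using (h i j).abs_sub_le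

theorem FlMul.frobNorm_sub_le {A : Matrix (Fin k) (Fin l) ℝ} {B : Matrix (Fin l) (Fin p) ℝ}
    {C : Matrix (Fin k) (Fin p) ℝ} (h : FlMul A B C) :
    frobNorm (C - A * B) ≤ gam l * (frobNorm A * frobNorm B) := by
  calc _ ≤ frobNorm (gam l • (A.map abs * B.map abs)) := frobNorm_mono h.abs_sub_le
    _ = gam l * frobNorm (A.map abs * B.map abs) := by
        rw [frobNorm_smul, abs_of_nonneg (gam_nonneg l)]
    _ ≤ _ := by
        refine mul_le_mul_of_nonneg_left ?_ (gam_nonneg l)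
        rw [← frobNorm_map_abs A, ← frobNorm_map_abs B]
        exact frobNorm_mul_le _ _

end Rounding

end CholQR

namespace CholQR

/-! ### Backward error and absence of breakdown in Cholesky factorization -/

section CholeskyAnalysis

variable {m n : ℕ}

open scoped Matrix

theorem sum_eq_add_sum_Iio {f : Fin n → ℝ} {j : Fin n} (h : ∀ i, j < i → f i = 0) :
    ∑ i, f i = f j + ∑ i ∈ Finset.Iio j, f i := by
  have h1 : ∑ i, f i = ∑ i ∈ Finset.Iic j, f i := by
    symm
    refine Finset.sum_subset (Finset.subset_univ _) fun i _ hi => h i ?_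
    simpa using hi
  rw [h1, ← Finset.Iio_insert, Finset.sum_insert (by simp)]

theorem gram_apply (A : Matrix (Fin m) (Fin n) ℝ) (c d : Fin n) :
    (Aᵀ * A) c d = ∑ k, A k c * A k d := by
  simp [Matrix.mul_apply]

theorem gram_comm (A : Matrix (Fin m) (Fin n) ℝ) (c d : Fin n) :
    (Aᵀ * A) c d = (Aᵀ * A) d c := by
  simp [gram_apply, mul_comm]

theorem gram_abs_diag (A : Matrix (Fin m) (Fin n) ℝ) (c : Fin n) :
    ((A.map abs)ᵀ * A.map abs) c c = (Aᵀ * A) c c := by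
  simp [gram_apply]

theorem frobNorm_sq_eq_sum_gram (A : Matrix (Fin m) (Fin n) ℝ) :
    frobNorm A ^ 2 = ∑ c, (Aᵀ * A) c c := by
  rw [frobNorm_sq, Finset.sum_comm]
  simp [gram_apply, pow_two]

theorem CholOff.abs_sub_le {G R : Matrix (Fin n) (Fin n) ℝ} {i j : Fin n}
    (h : CholOff G R i j) (hi : ∀ k, i < k → R k i = 0) (hii : R i i ≠ 0) :
    |(∑ k, R k i * R k j) - G i j| ≤ gam (n + 1) * ∑ k, |R k i| * |R k j| := by
  obtain ⟨s, hs, hr⟩ := h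
  obtain ⟨f, hf, hrf⟩ := hr.exists_factor
  have hz : R i i * R i j = s * f := by
    rw [hrf]
    field_simp
  have := hs.abs_sub_le hf hz
  rw [sum_eq_add_sum_Iio (f := fun k => R k i * R k j) (j := i) fun k hk => by simp [hi k hk],
    sum_eq_add_sum_Iio (f := fun k => |R k i| * |R k j|) (j := i) fun k hk => by simp [hi k hk]]
  refine this.trans ?_
  rw [abs_mul]
  refine mul_le_mul_of_nonneg_right (gam_mono ?_) (by positivity)
  simp only [Fin.card_Iio]
  omega

theorem CholCol.diag_pos {G R : Matrix (Fin n) (Fin n) ℝ} {j : Fin n} (h : CholCol G R j) :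
    0 < R j j := by
  obtain ⟨-, ⟨s, -, hs0, hr⟩, -⟩ := h
  obtain ⟨f, hf, hrf⟩ := hr.exists_factor
  rw [hrf]
  exact mul_pos (Real.sqrt_pos.2 hs0) hf.pos

theorem CholCol.abs_sub_le_diag {G R : Matrix (Fin n) (Fin n) ℝ} {j : Fin n}
    (h : CholCol G R j) :
    |(∑ k, R k j * R k j) - G j j| ≤ gam (n + 1) * ∑ k, |R k j| * |R k j| := by
  obtain ⟨-, ⟨s, hs, hs0, hr⟩, hj⟩ := h
  obtain ⟨f, hf, hrf⟩ := hr.exists_factor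
  -- Squaring the rounded square root counts its rounding twice. With the `j` subtracted products
  -- this makes `j + 2 ≤ n + 1` factors, hence `gam (n + 1)`.
  have hz : R j j * R j j = s * (f * f) := by
    rw [hrf]
    linear_combination f ^ 2 * Real.mul_self_sqrt hs0.le
  have := FlSubDot.abs_sub_le hs (hf.mul hf) hz
  rw [sum_eq_add_sum_Iio (f := fun k => R k j * R k j) (j := j) fun k hk => by simp [hj k hk],
    sum_eq_add_sum_Iio (f := fun k => |R k j| * |R k j|) (j := j) fun k hk => by simp [hj k hk]]
  refine this.trans ?_
  rw [abs_mul]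
  refine mul_le_mul_of_nonneg_right (gam_mono ?_) (by positivity)
  simp only [Fin.card_Iio]
  omega

/-- In `G j j = s * a + ∑ R k j ^ 2 * b k` the first term is non-positive and can be dropped. No
bound in the other direction follows, since `s` may be very negative. -/
theorem CholPivot.le_of_nonpos {G R : Matrix (Fin n) (Fin n) ℝ} {j : Fin n} {s : ℝ}
    (h : CholPivot G R j s) (hs : s ≤ 0) :
    G j j ≤ (1 + gam (n + 1)) * ∑ k ∈ Finset.Iio j, R k j * R k j := by
  have h2 : gam ((Finset.Iio j).card) ≤ gam (n + 1) := by
    refine gam_mono ?_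
    simp only [Fin.card_Iio]
    omega
  obtain ⟨a, b, ha, hb, hc⟩ := FlSubDot.exists_factors h
  have h3 : G j j ≤ ∑ k ∈ Finset.Iio j, R k j * R k j * b k := by
    rw [hc]
    have := mul_nonpos_of_nonpos_of_nonneg hs ha.pos.le
    linarith
  refine h3.trans ?_
  rw [Finset.mul_sum]
  refine Finset.sum_le_sum fun k hk => ?_
  rw [mul_comm]
  refine mul_le_mul_of_nonneg_right ?_ (mul_self_nonneg _)
  have h4 := (le_abs_self _).trans (hb k hk).abs_sub_one_le
  linarith

/-- The Gram matrix `AᵀA` cannot be close, in the sense of componentwise backward errors, to the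
Gram matrix of a matrix `P` with a kernel vector `x` supported on the indices up to `j`; the diagonal
entry at `j` is only controlled from one side. -/
theorem false_of_gram_close_of_mulVec_eq_zero {A : Matrix (Fin m) (Fin n) ℝ}
    {P : Matrix (Fin n) (Fin n) ℝ} {j : Fin n} {x : Fin n → ℝ} (hx : x ≠ 0) (hP : P *ᵥ x = 0)
    (hxj : ∀ c, j < c → x c = 0) (hPj : ∀ c, j < c → ∀ k, P k c = 0) {l a b g B : ℝ}
    (ha : 0 ≤ a) (ha1 : a ≤ 1) (hb : 0 ≤ b) (hl : ∀ y : Fin n → ℝ, l * (y ⬝ᵥ y) ≤ (A *ᵥ y) ⬝ᵥ (A *ᵥ y))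
    (hclose : ∀ c d, c ≤ j → d ≤ j → (c < j ∨ d < j) → |(Pᵀ * P) c d - (Aᵀ * A) c d| ≤
      a * ((A.map abs)ᵀ * A.map abs) c d + b * ((P.map abs)ᵀ * P.map abs) c d)
    (hg : g ≤ (1 + b) * (Pᵀ * P) j j) (hgA : |g - (Aᵀ * A) j j| ≤ a * (Aᵀ * A) j j)
    (hB : g + ∑ c ∈ Finset.Iio j, (Pᵀ * P) c c ≤ B)
    (hlt : a * frobNorm A ^ 2 + b * B < l) : False := by
  set ρ := (Pᵀ * P) j j with hρ
  set α := (Aᵀ * A) j j with hα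
  have hdiag : ∀ c, 0 ≤ (Pᵀ * P) c c := fun c => by
    rw [gram_apply]; exact Finset.sum_nonneg fun k _ => mul_self_nonneg _
  have hαF : α ≤ frobNorm A ^ 2 := by
    rw [frobNorm_sq_eq_sum_gram]
    refine Finset.single_le_sum (f := fun c => (Aᵀ * A) c c) (fun c _ => ?_) (Finset.mem_univ j)
    rw [gram_apply]; exact Finset.sum_nonneg fun k _ => mul_self_nonneg _
  have hlα : l ≤ α := by
    have := hl (Pi.single j 1)
    rw [← dotProduct_mulVec_gram] at this
    simpa using this
  obtain ⟨hg1, hg2⟩ := abs_le.1 hgA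
  have hsumP : 0 ≤ ∑ c ∈ Finset.Iio j, (Pᵀ * P) c c := Finset.sum_nonneg fun c _ => hdiag c
  have hglow : l - a * frobNorm A ^ 2 ≤ g := by nlinarith
  have hα0 : 0 ≤ α := by
    rw [hα, gram_apply]; exact Finset.sum_nonneg fun k _ => mul_self_nonneg _
  have hg_nonneg : 0 ≤ g := by nlinarith
  have hB0 : 0 ≤ B := by linarith
  have hbB0 : 0 ≤ b * B := by positivity
  have hg0 : 0 < g := by linarith
  have hρ0 : 0 < ρ := by
    by_contra h
    nlinarith
  -- `ρ` may far exceed `g`, so `B` need not bound `‖P‖_F²`. The weight `ρ / h` on index `j` reduces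
  -- the contribution of that column to `h ≤ g`. The price is an extra `b * B * (ρ / h - 1) * x j ^
  -- 2`, paid for by the surplus `(ρ - h) * x j ^ 2` in the diagonal term of the quadratic form.
  set h := min ρ g with hh
  have hh0 : 0 < h := lt_min hρ0 hg0
  have hhρ : h ≤ ρ := min_le_left _ _
  set D : Fin n → ℝ := fun c => if c = j then ρ / h else 1 with hD
  have hD0 : ∀ c, 0 < D c := fun c => by
    simp only [hD]; split_ifs
    · positivity
    · exact one_pos
  set z : Fin n → ℝ := fun c => |x c| with hz
  have hzz : z ⬝ᵥ z = x ⬝ᵥ x := by simp [hz, dotProduct]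
  have hxx : 0 < x ⬝ᵥ x := by
    rw [dotProduct_self_eq_norm_sq]
    have : WithLp.toLp 2 x ≠ 0 := by simpa using hx
    positivity
  have hzA : (A.map abs *ᵥ z) ⬝ᵥ (A.map abs *ᵥ z) ≤ frobNorm A ^ 2 * (x ⬝ᵥ x) := by
    refine (dotProduct_mulVec_self_le _ _).trans ?_
    rw [hzz, ← frobNorm_map_abs A]
    gcongr
    · exact twoNorm_nonneg _
    · exact twoNorm_le_frobNorm _
  have hzP : (P.map abs *ᵥ z) ⬝ᵥ (P.map abs *ᵥ z) ≤ B * (x ⬝ᵥ x + (ρ / h - 1) * x j ^ 2) := by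
    have h1 : ∑ c, D c * x c ^ 2 = x ⬝ᵥ x + (ρ / h - 1) * x j ^ 2 := by
      have : ∀ c, D c * x c ^ 2 = x c * x c + if c = j then (ρ / h - 1) * x j ^ 2 else 0 := by
        intro c
        simp only [hD]
        split_ifs with hc
        · subst hc; ring
        · ring
      simp only [this, Finset.sum_add_distrib, Finset.sum_ite_eq', Finset.mem_univ, if_true]
      rfl
    have h2 : ∑ c, (D c)⁻¹ * (Pᵀ * P) c c ≤ B := by
      rw [sum_eq_add_sum_Iio (j := j) fun c hc => by simp [gram_apply, hPj c hc]]
      refine le_trans (add_le_add ?_ (le_of_eq ?_)) hB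
      · simp only [hD, if_true, ← hρ]
        rw [inv_div, div_mul_cancel₀ _ hρ0.ne']
        exact min_le_right _ _
      · refine Finset.sum_congr rfl fun c hc => ?_
        simp [hD, (Finset.mem_Iio.1 hc).ne]
    -- Cauchy–Schwarz in each row, with the weights `D`.
    have h3 : ∀ k, (P.map abs *ᵥ z) k * (P.map abs *ᵥ z) k ≤
        (∑ c, (D c)⁻¹ * (P k c * P k c)) * ∑ c, D c * x c ^ 2 := by
      intro k
      have := Finset.sum_mul_sq_le_sq_mul_sq Finset.univ (fun c => |P k c| * (√(D c))⁻¹)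
        (fun c => √(D c) * z c)
      have e1 : ∀ c, |P k c| * (√(D c))⁻¹ * (√(D c) * z c) = P.map abs k c * z c := by
        intro c
        have := (Real.sqrt_pos.2 (hD0 c)).ne'
        simp only [Matrix.map_apply]
        field_simp
      have e2 : ∀ c, (|P k c| * (√(D c))⁻¹) ^ 2 = (D c)⁻¹ * (P k c * P k c) := by
        intro c
        rw [mul_pow, inv_pow, Real.sq_sqrt (hD0 c).le, sq_abs]; ring
      have e3 : ∀ c, (√(D c) * z c) ^ 2 = D c * x c ^ 2 := by
        intro c
        rw [mul_pow, Real.sq_sqrt (hD0 c).le, sq_abs]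
      simp only [e1, e2, e3] at this
      rw [← pow_two]
      exact this
    rw [← h1]
    calc _ ≤ ∑ k, (∑ c, (D c)⁻¹ * (P k c * P k c)) * ∑ c, D c * x c ^ 2 :=
          Finset.sum_le_sum fun k _ => h3 k
      _ = (∑ c, (D c)⁻¹ * (Pᵀ * P) c c) * ∑ c, D c * x c ^ 2 := by
          rw [← Finset.sum_mul, Finset.sum_comm]
          simp only [gram_apply, Finset.mul_sum]
      _ ≤ _ := mul_le_mul_of_nonneg_right h2
          (Finset.sum_nonneg fun c _ => mul_nonneg (hD0 c).le (sq_nonneg _))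
  have hterm : ∀ c d, (if c = j then if d = j then (ρ - h) * x j ^ 2 else 0 else 0)
      - (a * (z c * (((A.map abs)ᵀ * A.map abs) c d * z d))
        + b * (z c * (((P.map abs)ᵀ * P.map abs) c d * z d)))
      ≤ x c * ((Pᵀ * P) c d * x d) - x c * ((Aᵀ * A) c d * x d) := by
    intro c d
    by_cases hcd : (c ≤ j ∧ d ≤ j) ∧ (c < j ∨ d < j)
    · have h1 := hclose c d hcd.1.1 hcd.1.2 hcd.2
      have h2 : (if c = j then if d = j then (ρ - h) * x j ^ 2 else 0 else 0) = 0 := by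
        split_ifs with h3 h4
        · subst h3 h4; simp at hcd
        · rfl
        · rfl
      rw [h2]
      have h3 : |x c * ((Pᵀ * P) c d * x d) - x c * ((Aᵀ * A) c d * x d)| =
          z c * z d * |(Pᵀ * P) c d - (Aᵀ * A) c d| := by
        simp only [hz]
        rw [← abs_mul, ← abs_mul]; congr 1; ring
      have h4 := mul_le_mul_of_nonneg_left h1 (mul_nonneg (abs_nonneg (x c)) (abs_nonneg (x d)))
      have h5 := neg_abs_le (x c * ((Pᵀ * P) c d * x d) - x c * ((Aᵀ * A) c d * x d))
      rw [h3] at h5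
      simp only [hz] at h5 ⊢
      linarith
    · by_cases hc : j < c
      · simp [hz, hxj c hc, hc.ne']
      by_cases hd : j < d
      · simp [hz, hxj d hd, hd.ne']
      have hc' : c = j := by
        by_contra hne
        exact hcd ⟨⟨not_lt.1 hc, not_lt.1 hd⟩, Or.inl (lt_of_le_of_ne (not_lt.1 hc) hne)⟩
      have hd' : d = j := by
        by_contra hne
        exact hcd ⟨⟨not_lt.1 hc, not_lt.1 hd⟩, Or.inr (lt_of_le_of_ne (not_lt.1 hd) hne)⟩
      subst hc' hd'
      rw [gram_abs_diag, gram_abs_diag, ← hρ, ← hα]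
      simp only [if_true, hz]
      have h1 : |x d| * |x d| = x d ^ 2 := by rw [← pow_two, sq_abs]
      -- This is where the one-sided information at `(j, j)` suffices: `g ≤ (1 + b) * ρ` gives `g -
      -- b * ρ ≤ h`, and `α ≤ g + a * α`.
      have h2 : ρ - h - (a * α + b * ρ) ≤ ρ - α := by
        have : g - b * ρ ≤ h := by
          refine le_min (by linarith) ?_
          have := mul_nonneg hb hρ0.le
          linarith
        linarith
      have h3 := mul_le_mul_of_nonneg_right h2 (sq_nonneg (x d))
      have h4 : a * (|x d| * (α * |x d|)) + b * (|x d| * (ρ * |x d|))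
          = (a * α + b * ρ) * x d ^ 2 := by rw [← h1]; ring
      rw [h4]
      linarith
  have hsum := Finset.sum_le_sum fun c (_ : c ∈ Finset.univ) =>
    Finset.sum_le_sum fun d (_ : d ∈ Finset.univ) => hterm c d
  have hquad : ∀ {p : ℕ} (C : Matrix (Fin p) (Fin n) ℝ) (y : Fin n → ℝ),
      ∑ c, ∑ d, y c * ((Cᵀ * C) c d * y d) = (C *ᵥ y) ⬝ᵥ (C *ᵥ y) := by
    intro p C y
    rw [← dotProduct_mulVec_gram]
    simp [dotProduct, Matrix.mulVec, Finset.mul_sum]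
  have e1 : ∑ c, ∑ d, (if c = j then if d = j then (ρ - h) * x j ^ 2 else 0 else 0)
      = (ρ - h) * x j ^ 2 := by
    rw [Finset.sum_eq_single j (fun c _ hc => by simp [hc]) (by simp)]
    simp
  have e2 : ∀ (r : ℝ) (f : Fin n → Fin n → ℝ), ∑ c, ∑ d, r * f c d = r * ∑ c, ∑ d, f c d := by
    intro r f
    simp only [Finset.mul_sum]
  simp only [Finset.sum_sub_distrib, Finset.sum_add_distrib] at hsum
  rw [e1, e2 a, e2 b, hquad, hquad, hquad, hquad, hP, zero_dotProduct] at hsum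
  have h1 := mul_le_mul_of_nonneg_left hzA ha
  have h2 := mul_le_mul_of_nonneg_left hzP hb
  have h3 := hl x
  -- The surplus pays the price: if `h = ρ` both sides vanish, and if `h = g` it is enough that `b *
  -- B < l - a * frobNorm A ^ 2 ≤ g`.
  have h4 : b * B * (ρ / h - 1) ≤ ρ - h := by
    have e : ρ / h - 1 = (ρ - h) / h := by field_simp
    rw [e, mul_div_assoc', div_le_iff₀ hh0, mul_comm]
    rcases min_choice ρ g with hc | hc
    · have : h = ρ := hc
      simp [this]
    · have : h = g := hc
      refine mul_le_mul_of_nonneg_left ?_ (by linarith)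
      linarith
  have h5 := mul_le_mul_of_nonneg_right h4 (sq_nonneg (x j))
  have h6 := mul_lt_mul_of_pos_right hlt hxx
  linarith

/-- In column `j` of a Cholesky factorization whose first `j` columns were computed successfully,
the pivot is positive. -/
theorem not_breakdown {A : Matrix (Fin m) (Fin n) ℝ} {G R : Matrix (Fin n) (Fin n) ℝ} {j : Fin n}
    {s l a B : ℝ} (ha : 0 ≤ a) (ha1 : a ≤ 1)
    (hl : ∀ y : Fin n → ℝ, l * (y ⬝ᵥ y) ≤ (A *ᵥ y) ⬝ᵥ (A *ᵥ y))
    (hG : ∀ c d, |G c d - (Aᵀ * A) c d| ≤ a * ((A.map abs)ᵀ * A.map abs) c d)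
    (hcol : ∀ k < j, CholCol G R k) (hoff : ∀ i < j, CholOff G R i j) (hs : CholPivot G R j s)
    (hB : G j j + ∑ c ∈ Finset.Iio j, ∑ k, R k c * R k c ≤ B)
    (hlt : a * frobNorm A ^ 2 + gam (n + 1) * B < l) : 0 < s := by
  by_contra hs0
  rw [not_lt] at hs0
  -- `P` keeps the `j` finished rows and the first `j + 1` columns of `R`, so it kills a nonzero
  -- vector supported on indices up to `j`. The identity block added in `M` forces that support,
  -- while row `j` of `M` stays zero.
  set P : Matrix (Fin n) (Fin n) ℝ :=
    Matrix.of fun k c => if k < j ∧ c ≤ j then R k c else 0 with hP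
  set M : Matrix (Fin n) (Fin n) ℝ :=
    Matrix.of fun k c => P k c + if j < k ∧ k = c then 1 else 0 with hM
  have hdet : M.det = 0 := by
    refine Matrix.det_eq_zero_of_row_eq_zero j fun c => ?_
    simp [hM, hP]
  obtain ⟨x, hx, hMx⟩ := Matrix.exists_mulVec_eq_zero_iff.2 hdet
  have hxj : ∀ c, j < c → x c = 0 := by
    intro c hc
    have := congrFun hMx c
    simpa [Matrix.mulVec, dotProduct, hM, hP, hc, hc.not_gt] using this
  have hPx : P *ᵥ x = 0 := by
    ext k
    rcases lt_or_ge k j with hk | hk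
    · have := congrFun hMx k
      simpa [Matrix.mulVec, dotProduct, hM, hk.not_gt] using this
    · simp [Matrix.mulVec, dotProduct, hP, hk.not_gt]
  have hPR : ∀ c, c < j → ∀ k, P k c = R k c := by
    intro c hc k
    rcases lt_or_ge k j with hk | hk
    · simp [hP, hk, hc.le]
    · simp [hP, hk.not_gt, (hcol c hc).2.2 k (hc.trans_le hk)]
  have hPj : ∀ k, P k j = if k < j then R k j else 0 := by
    intro k
    simp [hP]
  have hmix : ∀ c, c < j → ∀ k, R k c * P k j = R k c * R k j := by
    intro c hc k
    rw [hPj]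
    split_ifs with hk
    · rfl
    · rw [(hcol c hc).2.2 k (hc.trans_le (not_lt.1 hk))]; simp
  have hRG : ∀ c d, c ≤ d → d ≤ j → c < j → |(Pᵀ * P) c d - G c d| ≤
      gam (n + 1) * ((P.map abs)ᵀ * P.map abs) c d := by
    intro c d hcd hd hc
    have hzero := (hcol c hc).2.2
    have key : |(∑ k, R k c * R k d) - G c d| ≤ gam (n + 1) * ∑ k, |R k c| * |R k d| := by
      rcases hcd.eq_or_lt with rfl | hcd
      · exact (hcol c hc).abs_sub_le_diag
      · refine CholOff.abs_sub_le ?_ hzero (hcol c hc).diag_pos.ne'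
        rcases hd.eq_or_lt with rfl | hd
        · exact hoff c hc
        · exact (hcol d hd).1 c hcd
    have e : ∀ k, P k c * P k d = R k c * R k d := by
      intro k
      rw [hPR c hc]
      rcases hd.eq_or_lt with rfl | hd
      · exact hmix c hc k
      · rw [hPR d hd]
    have e' : ∀ k, |P k c| * |P k d| = |R k c| * |R k d| := by
      intro k
      rw [← abs_mul, e, abs_mul]
    simpa only [gram_apply, Matrix.map_apply, e, e'] using key
  have hPP : (Pᵀ * P) j j = ∑ k ∈ Finset.Iio j, R k j * R k j := by
    rw [gram_apply, sum_eq_add_sum_Iio (j := j) fun i hi => by simp [hPj, hi.not_gt]]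
    simp only [hPj, lt_irrefl, if_false, zero_mul, zero_add]
    refine Finset.sum_congr rfl fun k hk => ?_
    simp [Finset.mem_Iio.1 hk]
  refine false_of_gram_close_of_mulVec_eq_zero (A := A) (a := a) (b := gam (n + 1)) (g := G j j)
    (B := B) hx hPx hxj ?_ ha ha1 (gam_nonneg _) hl ?_ ?_ ?_ ?_ hlt
  · intro c hc k
    simp [hP, hc.not_ge]
  · intro c d hc hd hcd
    have main : ∀ c d, c ≤ d → d ≤ j → c < j → |(Pᵀ * P) c d - (Aᵀ * A) c d| ≤
        a * ((A.map abs)ᵀ * A.map abs) c d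
          + gam (n + 1) * ((P.map abs)ᵀ * P.map abs) c d := by
      intro c d hcd hd hc
      have h1 := hRG c d hcd hd hc
      have h2 := hG c d
      have h3 := abs_add_le ((Pᵀ * P) c d - G c d) (G c d - (Aᵀ * A) c d)
      rw [sub_add_sub_cancel] at h3
      linarith
    rcases le_total c d with h | h
    · refine main c d h hd ?_
      rcases hcd with h' | h'
      · exact h'
      · exact h.trans_lt h'
    · rw [gram_comm P, gram_comm A, gram_comm (A.map abs), gram_comm (P.map abs)]
      refine main d c h hc ?_
      rcases hcd with h' | h'
      · exact h.trans_lt h'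
      · exact h'
  · rw [hPP]
    exact CholPivot.le_of_nonpos hs hs0
  · have := hG j j
    rwa [gram_abs_diag] at this
  · convert hB using 2
    refine Finset.sum_congr rfl fun c hc => ?_
    rw [gram_apply]
    simp only [hPR c (Finset.mem_Iio.1 hc)]

/-- The constant comes from `(1 + 1/60) / (1 - 1/60) = 61/59 < 1.04`. -/
theorem CholCol.sum_sq_le {A : Matrix (Fin m) (Fin n) ℝ} {G R : Matrix (Fin n) (Fin n) ℝ}
    {j : Fin n} (h : CholCol G R j)
    (hG : |G j j - (Aᵀ * A) j j| ≤ gam m * ((A.map abs)ᵀ * A.map abs) j j)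
    (ha1 : gam m ≤ 1 / 60) (hb1 : gam (n + 1) ≤ 1 / 60) :
    ∑ k, R k j * R k j ≤ 1.04 * (Aᵀ * A) j j := by
  have h1 := h.abs_sub_le_diag
  rw [gram_abs_diag] at hG
  simp only [abs_mul_abs_self] at h1
  have h2 : 0 ≤ ∑ k, R k j * R k j := Finset.sum_nonneg fun k _ => mul_self_nonneg _
  have h3 : 0 ≤ (Aᵀ * A) j j := by
    rw [gram_apply]; exact Finset.sum_nonneg fun k _ => mul_self_nonneg _
  have h4 := (abs_le.1 h1).2
  have h5 := (abs_le.1 hG).2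
  have h6 := mul_le_mul_of_nonneg_right ha1 h3
  have h7 := mul_le_mul_of_nonneg_right hb1 h2
  norm_num
  linarith

theorem FlCholesky.exists_some {A : Matrix (Fin m) (Fin n) ℝ} {G : Matrix (Fin n) (Fin n) ℝ}
    {out : Option (Matrix (Fin n) (Fin n) ℝ)} {l : ℝ}
    (hl : ∀ y : Fin n → ℝ, l * (y ⬝ᵥ y) ≤ (A *ᵥ y) ⬝ᵥ (A *ᵥ y))
    (hG : FlMul Aᵀ A G) (hout : FlCholesky G out)
    (ha1 : gam m ≤ 1 / 60) (hb1 : gam (n + 1) ≤ 1 / 60)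
    (hlt : 1.04 * (gam m + gam (n + 1)) * frobNorm A ^ 2 < l) :
    ∃ R, out = some R ∧ ∀ j, CholCol G R j := by
  cases hout with
  | done R hR => exact ⟨R, rfl, hR⟩
  | breakdown R j s hcol hoff hs hs0 =>
    exfalso
    have hG' : ∀ c d, |G c d - (Aᵀ * A) c d| ≤ gam m * ((A.map abs)ᵀ * A.map abs) c d := by
      intro c d
      have := hG.abs_sub_le c d
      rwa [Matrix.transpose_map] at this
    have hdiag : ∀ c, 0 ≤ (Aᵀ * A) c c := fun c => by
      rw [gram_apply]; exact Finset.sum_nonneg fun k _ => mul_self_nonneg _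
    have hB : G j j + ∑ c ∈ Finset.Iio j, ∑ k, R k c * R k c ≤ 1.04 * frobNorm A ^ 2 := by
      have h1 : G j j ≤ 1.04 * (Aᵀ * A) j j := by
        have := hG' j j
        rw [gram_abs_diag] at this
        have h2 := (abs_le.1 this).2
        have h3 := mul_le_mul_of_nonneg_right ha1 (hdiag j)
        have := hdiag j
        norm_num
        linarith
      have h2 : ∑ c ∈ Finset.Iio j, ∑ k, R k c * R k c ≤ ∑ c ∈ Finset.Iio j, 1.04 * (Aᵀ * A) c c :=
        Finset.sum_le_sum fun c hc => (hcol c (Finset.mem_Iio.1 hc)).sum_sq_le (hG' c c) ha1 hb1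
      have h3 : ∑ c ∈ Finset.Iic j, (Aᵀ * A) c c ≤ frobNorm A ^ 2 := by
        rw [frobNorm_sq_eq_sum_gram]
        exact Finset.sum_le_sum_of_subset_of_nonneg (Finset.subset_univ _) fun c _ _ => hdiag c
      rw [← Finset.Iio_insert, Finset.sum_insert (by simp)] at h3
      rw [← Finset.mul_sum] at h2
      have h4 := mul_le_mul_of_nonneg_left h3 (by norm_num : (0 : ℝ) ≤ 1.04)
      rw [mul_add] at h4
      linarith
    refine hs0.not_gt (not_breakdown (gam_nonneg m) (by linarith) hl hG' hcol hoff hs hB ?_)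
    have := mul_nonneg (gam_nonneg m) (sq_nonneg (frobNorm A))
    norm_num at hlt ⊢
    linarith

theorem FlTriSolve.frobNorm_sub_le {A Q : Matrix (Fin m) (Fin n) ℝ} {S : Matrix (Fin n) (Fin n) ℝ}
    (h : FlTriSolve A S Q) (hdiag : ∀ j, S j j ≠ 0) (htri : ∀ i j, j < i → S i j = 0) :
    frobNorm (Q * S - A) ≤ gam n * (frobNorm Q * frobNorm S) := by
  have key : ∀ i j, |(Q * S - A) i j| ≤ (gam n • (Q.map abs * S.map abs)) i j := by
    intro i j
    obtain ⟨s, hs, hr⟩ := h i j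
    obtain ⟨f, hf, hrf⟩ := hr.exists_factor
    have hz : Q i j * S j j = s * f := by
      rw [hrf]
      field_simp [hdiag j]
    have := hs.abs_sub_le hf hz
    simp only [Matrix.sub_apply, Matrix.smul_apply, Matrix.mul_apply, Matrix.map_apply, smul_eq_mul]
    rw [sum_eq_add_sum_Iio (f := fun k => Q i k * S k j) (j := j) fun k hk => by simp [htri k j hk],
      sum_eq_add_sum_Iio (f := fun k => |Q i k| * |S k j|) (j := j)
        fun k hk => by simp [htri k j hk]]
    refine this.trans ?_
    rw [abs_mul]
    refine mul_le_mul_of_nonneg_right (gam_mono ?_) (by positivity)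
    simp only [Fin.card_Iio]
    omega
  calc _ ≤ _ := frobNorm_mono key
    _ = gam n * frobNorm (Q.map abs * S.map abs) := by
        rw [frobNorm_smul, abs_of_nonneg (gam_nonneg n)]
    _ ≤ _ := by
        refine mul_le_mul_of_nonneg_left ?_ (gam_nonneg n)
        rw [← frobNorm_map_abs Q, ← frobNorm_map_abs S]
        exact frobNorm_mul_le _ _

/-- Backward error analysis of one CholeskyQR step. -/
theorem FlCholeskyQR.exists_some {A : Matrix (Fin m) (Fin n) ℝ}
    {out : Option (Matrix (Fin m) (Fin n) ℝ × Matrix (Fin n) (Fin n) ℝ)} {l : ℝ}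
    (hout : FlCholeskyQR A out)
    (hl : ∀ y : Fin n → ℝ, l * (y ⬝ᵥ y) ≤ (A *ᵥ y) ⬝ᵥ (A *ᵥ y))
    (ha1 : gam m ≤ 1 / 60) (hb1 : gam (n + 1) ≤ 1 / 60)
    (hlt : 1.04 * (gam m + gam (n + 1)) * frobNorm A ^ 2 < l) :
    ∃ Q S, out = some (Q, S) ∧
      frobNorm (Sᵀ * S - Aᵀ * A) ≤ 1.04 * (gam m + gam (n + 1)) * frobNorm A ^ 2 ∧
      frobNorm S ^ 2 ≤ 1.04 * frobNorm A ^ 2 ∧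
      frobNorm (Q * S - A) ≤ gam n * (frobNorm Q * frobNorm S) := by
  cases hout with
  | breakdown G hG hC =>
    obtain ⟨R, hR, -⟩ := hC.exists_some hl hG ha1 hb1 hlt
    cases hR
  | done G S Q hG hC hQ =>
    obtain ⟨S', hS, hcol⟩ := hC.exists_some hl hG ha1 hb1 hlt
    cases hS
    have hG' : ∀ c d, |G c d - (Aᵀ * A) c d| ≤ gam m * ((A.map abs)ᵀ * A.map abs) c d := by
      intro c d
      have := hG.abs_sub_le c d
      rwa [Matrix.transpose_map] at this
    have hS2 : frobNorm S ^ 2 ≤ 1.04 * frobNorm A ^ 2 := by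
      rw [frobNorm_sq_eq_sum_gram, frobNorm_sq_eq_sum_gram, Finset.mul_sum]
      refine Finset.sum_le_sum fun c _ => ?_
      rw [gram_apply S]
      exact (hcol c).sum_sq_le (hG' c c) ha1 hb1
    refine ⟨Q, S, rfl, ?_, hS2,
      hQ.frobNorm_sub_le (fun j => (hcol j).diag_pos.ne') fun i j => (hcol j).2.2 i⟩
    -- Only the upper triangle of `G` is read, and the computed `G` need not be symmetric. The bound
    -- extends below the diagonal because all the exact Gram matrices in it are symmetric.
    have main : ∀ c d, c ≤ d → |(Sᵀ * S - Aᵀ * A) c d| ≤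
        (gam m • ((A.map abs)ᵀ * A.map abs) + gam (n + 1) • ((S.map abs)ᵀ * S.map abs)) c d := by
      intro c d hcd
      have key : |(∑ k, S k c * S k d) - G c d| ≤ gam (n + 1) * ∑ k, |S k c| * |S k d| := by
        rcases hcd.eq_or_lt with rfl | hcd
        · exact (hcol c).abs_sub_le_diag
        · exact ((hcol d).1 c hcd).abs_sub_le (hcol c).2.2 (hcol c).diag_pos.ne'
      have h2 := hG' c d
      have h3 := abs_add_le ((Sᵀ * S) c d - G c d) (G c d - (Aᵀ * A) c d)
      rw [sub_add_sub_cancel, gram_apply S] at h3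
      simp only [Matrix.sub_apply, Matrix.add_apply, Matrix.smul_apply, smul_eq_mul, gram_apply S,
        gram_apply (S.map abs), Matrix.map_apply]
      linarith
    have all : ∀ c d, |(Sᵀ * S - Aᵀ * A) c d| ≤
        (gam m • ((A.map abs)ᵀ * A.map abs) + gam (n + 1) • ((S.map abs)ᵀ * S.map abs)) c d := by
      intro c d
      rcases le_total c d with h | h
      · exact main c d h
      · have := main d c h
        simp only [Matrix.sub_apply, Matrix.add_apply, Matrix.smul_apply] at this ⊢
        rwa [gram_comm S, gram_comm A, gram_comm (A.map abs), gram_comm (S.map abs)]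
    have hgram : ∀ {p : ℕ} (C : Matrix (Fin p) (Fin n) ℝ),
        frobNorm ((C.map abs)ᵀ * C.map abs) ≤ frobNorm C ^ 2 := by
      intro p C
      have := frobNorm_mul_le (C.map abs)ᵀ (C.map abs)
      rwa [frobNorm_transpose, frobNorm_map_abs, ← pow_two] at this
    refine (frobNorm_mono all).trans ((frobNorm_add_le _ _).trans ?_)
    rw [frobNorm_smul, frobNorm_smul, abs_of_nonneg (gam_nonneg _), abs_of_nonneg (gam_nonneg _)]
    have h1 := mul_le_mul_of_nonneg_left (hgram A) (gam_nonneg m)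
    have h2 := mul_le_mul_of_nonneg_left ((hgram S).trans hS2) (gam_nonneg (n + 1))
    have := mul_nonneg (gam_nonneg m) (sq_nonneg (frobNorm A))
    norm_num at h2 ⊢
    linarith

end CholeskyAnalysis

end CholQR

namespace CholQR

/-! ### Orthogonality of the computed factor -/

section Perturbation

variable {m n : ℕ}

open scoped Matrix

theorem dotProduct_self_nonneg_real (x : Fin n → ℝ) : 0 ≤ x ⬝ᵥ x := by
  rw [dotProduct_self_eq_norm_sq]; positivity

theorem abs_mulVec_sub_mulVec_le {p : ℕ} {A : Matrix (Fin m) (Fin n) ℝ}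
    {S : Matrix (Fin p) (Fin n) ℝ} {e : ℝ} (hE : frobNorm (Sᵀ * S - Aᵀ * A) ≤ e) (x : Fin n → ℝ) :
    |(S *ᵥ x) ⬝ᵥ (S *ᵥ x) - (A *ᵥ x) ⬝ᵥ (A *ᵥ x)| ≤ e * (x ⬝ᵥ x) := by
  rw [← dotProduct_mulVec_gram, ← dotProduct_mulVec_gram, ← dotProduct_sub, ← Matrix.sub_mulVec]
  exact (abs_dotProduct_mulVec_le _ x).trans
    (mul_le_mul_of_nonneg_right hE (dotProduct_self_nonneg_real x))

theorem abs_mulVec_sub_self_le {A : Matrix (Fin m) (Fin n) ℝ} {e : ℝ}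
    (hE : frobNorm (Aᵀ * A - 1) ≤ e) (x : Fin n → ℝ) :
    |(A *ᵥ x) ⬝ᵥ (A *ᵥ x) - x ⬝ᵥ x| ≤ e * (x ⬝ᵥ x) := by
  have := abs_mulVec_sub_mulVec_le (A := (1 : Matrix (Fin n) (Fin n) ℝ)) (S := A) (e := e)
    (by simpa using hE) x
  simpa using this

/-- If `SᵀS` is close to `AᵀA`, then `A S⁻¹` is nearly orthogonal. -/
theorem exists_near_orthogonal {A Q : Matrix (Fin m) (Fin n) ℝ} {S : Matrix (Fin n) (Fin n) ℝ}
    {l e : ℝ} (hl : ∀ y : Fin n → ℝ, l * (y ⬝ᵥ y) ≤ (A *ᵥ y) ⬝ᵥ (A *ᵥ y))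
    (hE : frobNorm (Sᵀ * S - Aᵀ * A) ≤ e) (he : e < l) :
    ∃ P : Matrix (Fin m) (Fin n) ℝ, frobNorm (Pᵀ * P - 1) ≤ e / (l - e) ∧
      frobNorm (Q - P) ≤ frobNorm (Q * S - A) / √(l - e) := by
  have hle : 0 < l - e := sub_pos.2 he
  have hlow : ∀ x : Fin n → ℝ, (l - e) * (x ⬝ᵥ x) ≤ (S *ᵥ x) ⬝ᵥ (S *ᵥ x) := by
    intro x
    have h1 := (abs_le.1 (abs_mulVec_sub_mulVec_le hE x)).1
    have h2 := hl x
    linarith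
  have hdet : S.det ≠ 0 := by
    intro h0
    obtain ⟨x, hx, hSx⟩ := Matrix.exists_mulVec_eq_zero_iff.2 h0
    have h1 := hlow x
    rw [hSx, zero_dotProduct] at h1
    have h2 : 0 < x ⬝ᵥ x := by
      rw [dotProduct_self_eq_norm_sq]
      have : WithLp.toLp 2 x ≠ 0 := by simpa using hx
      positivity
    have := mul_pos hle h2
    linarith
  have hunit : IsUnit S.det := isUnit_iff_ne_zero.2 hdet
  have hSS : S * S⁻¹ = 1 := Matrix.mul_nonsing_inv S hunit
  have hinv : twoNorm S⁻¹ ≤ (√(l - e))⁻¹ := by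
    refine twoNorm_le (by positivity) fun y => ?_
    rw [inv_pow, Real.sq_sqrt hle.le, inv_mul_eq_div, le_div_iff₀ hle, mul_comm]
    have := hlow (S⁻¹ *ᵥ y)
    rwa [Matrix.mulVec_mulVec, hSS, Matrix.one_mulVec] at this
  have he0 : 0 ≤ e := (frobNorm_nonneg _).trans hE
  refine ⟨A * S⁻¹, ?_, ?_⟩
  · have h1 : (A * S⁻¹)ᵀ * (A * S⁻¹) - 1 = S⁻¹ᵀ * (Aᵀ * A - Sᵀ * S) * S⁻¹ := by
      have h2 : S⁻¹ᵀ * (Sᵀ * S) * S⁻¹ = 1 := by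
        calc S⁻¹ᵀ * (Sᵀ * S) * S⁻¹ = (S * S⁻¹)ᵀ * (S * S⁻¹) := by
              rw [Matrix.transpose_mul]; simp only [Matrix.mul_assoc]
          _ = 1 := by rw [hSS]; simp
      rw [Matrix.mul_sub, Matrix.sub_mul, h2, Matrix.transpose_mul]
      simp only [Matrix.mul_assoc]
    rw [h1]
    calc _ ≤ frobNorm (S⁻¹ᵀ * (Aᵀ * A - Sᵀ * S)) * twoNorm S⁻¹ := frobNorm_mul_le_twoNorm_right _ _
      _ ≤ (twoNorm S⁻¹ᵀ * frobNorm (Aᵀ * A - Sᵀ * S)) * twoNorm S⁻¹ :=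
          mul_le_mul_of_nonneg_right (frobNorm_mul_le_twoNorm_left _ _) (twoNorm_nonneg _)
      _ ≤ ((√(l - e))⁻¹ * e) * (√(l - e))⁻¹ := by
          rw [twoNorm_transpose, frobNorm_sub_comm]
          have := twoNorm_nonneg S⁻¹
          have := frobNorm_nonneg (Sᵀ * S - Aᵀ * A)
          gcongr
      _ = e / (l - e) := by
          rw [mul_comm _ e, mul_assoc, ← mul_inv, Real.mul_self_sqrt hle.le, div_eq_mul_inv]
  · have h1 : Q - A * S⁻¹ = (Q * S - A) * S⁻¹ := by
      rw [Matrix.sub_mul, Matrix.mul_assoc, hSS, Matrix.mul_one]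
    rw [h1, div_eq_mul_inv]
    exact (frobNorm_mul_le_twoNorm_right _ _).trans
      (mul_le_mul_of_nonneg_left hinv (frobNorm_nonneg _))

/-- Orthogonality of the computed orthogonal factor of one CholeskyQR step. -/
theorem cholQR_orthogonality {A Q : Matrix (Fin m) (Fin n) ℝ} {S : Matrix (Fin n) (Fin n) ℝ}
    (hn : 0 < n) {l e g η C τ K t : ℝ}
    (hl : ∀ y : Fin n → ℝ, l * (y ⬝ᵥ y) ≤ (A *ᵥ y) ⬝ᵥ (A *ᵥ y))
    (hE : frobNorm (Sᵀ * S - Aᵀ * A) ≤ e) (he : e < l)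
    (hQ : frobNorm (Q * S - A) ≤ g * (frobNorm Q * frobNorm S))
    (hη : e ≤ η * (l - e)) (hC0 : 0 ≤ C) (hC : 1 + η ≤ C ^ 2) (ht0 : 0 ≤ t)
    (ht : g * frobNorm S * √n ≤ t * √(l - e)) (htτ : t ≤ τ) (hτ : τ < 1) (hK : C ≤ K * (1 - τ)) :
    frobNorm Q ≤ K * √n ∧ twoNorm Q ≤ K ∧
      frobNorm (Qᵀ * Q - 1) ≤ η + (2 * C + τ * K) * (t * K) := by
  obtain ⟨P, hP, hQP⟩ := exists_near_orthogonal (Q := Q) hl hE he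
  have hle : 0 < l - e := sub_pos.2 he
  have hr : 0 < √(l - e) := Real.sqrt_pos.2 hle
  have hn1 : 1 ≤ √(n : ℝ) := Real.one_le_sqrt.2 (by exact_mod_cast hn)
  have hn0 : 0 < √(n : ℝ) := by linarith
  have hPη : frobNorm (Pᵀ * P - 1) ≤ η := hP.trans ((div_le_iff₀ hle).2 hη)
  have hPC : twoNorm P ≤ C := by
    refine twoNorm_le hC0 fun x => ?_
    have h1 := (abs_le.1 (abs_mulVec_sub_self_le hPη x)).2
    have h2 := mul_le_mul_of_nonneg_right hC (dotProduct_self_nonneg_real x)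
    linarith
  have hK0 : 0 ≤ K := by
    by_contra h
    nlinarith
  -- The error bound contains `‖Q‖_F` itself; since `t ≤ τ < 1` it can be absorbed on the left. `τ`
  -- is a numerical ceiling, while `t` may keep its dependence on `n` and `u`. The factor `√n` later
  -- cancels the one in `‖Q‖_F ≤ K √n`.
  have hD : frobNorm (Q - P) * √n ≤ t * frobNorm Q := by
    have h1 : frobNorm (Q - P) * √(l - e) ≤ g * (frobNorm Q * frobNorm S) :=
      ((le_div_iff₀ hr).1 hQP).trans hQ
    have h2 := mul_le_mul_of_nonneg_right h1 hn0.le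
    have h3 := mul_le_mul_of_nonneg_right ht (frobNorm_nonneg Q)
    refine le_of_mul_le_mul_right ?_ hr
    linarith
  have hsplit : P + (Q - P) = Q := by abel
  have hPF : frobNorm P ≤ √n * C :=
    (frobNorm_le_sqrt_mul_twoNorm P).trans (mul_le_mul_of_nonneg_left hPC hn0.le)
  have hQF : frobNorm Q ≤ K * √n := by
    have h1 := frobNorm_add_le P (Q - P)
    rw [hsplit] at h1
    have h2 : frobNorm (Q - P) ≤ τ * frobNorm Q := by
      have h3 : frobNorm (Q - P) ≤ frobNorm (Q - P) * √n :=
        le_mul_of_one_le_right (frobNorm_nonneg _) hn1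
      have h4 := mul_le_mul_of_nonneg_right htτ (frobNorm_nonneg Q)
      linarith
    have h5 := mul_le_mul_of_nonneg_left hK hn0.le
    have h6 : 0 < 1 - τ := by linarith
    refine le_of_mul_le_mul_right ?_ h6
    linarith
  have hDF : frobNorm (Q - P) ≤ t * K := by
    refine le_of_mul_le_mul_right ?_ hn0
    have := mul_le_mul_of_nonneg_left hQF ht0
    linarith
  have hDτ : frobNorm (Q - P) ≤ τ * K := hDF.trans (mul_le_mul_of_nonneg_right htτ hK0)
  refine ⟨hQF, ?_, ?_⟩
  · have h1 := twoNorm_add_le P (Q - P)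
    rw [hsplit] at h1
    have h2 := twoNorm_le_frobNorm (Q - P)
    linarith
  · set D := Q - P with hDdef
    have h1 : Qᵀ * Q - 1 = (Pᵀ * P - 1) + (Pᵀ * D + Dᵀ * Q) := by
      rw [hDdef, Matrix.transpose_sub]
      simp only [Matrix.mul_sub, Matrix.sub_mul]
      abel
    have h2 : frobNorm (Pᵀ * D) ≤ C * (t * K) := by
      refine (frobNorm_mul_le_twoNorm_left _ _).trans ?_
      rw [twoNorm_transpose]
      exact mul_le_mul hPC hDF (frobNorm_nonneg _) hC0
    have h3 : frobNorm (Dᵀ * Q) ≤ (t * K) * (C + τ * K) := by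
      refine (frobNorm_mul_le_twoNorm_right _ _).trans ?_
      rw [frobNorm_transpose]
      refine mul_le_mul hDF ?_ (twoNorm_nonneg _) (mul_nonneg ht0 hK0)
      have h4 := twoNorm_add_le P D
      rw [hsplit] at h4
      have h5 := twoNorm_le_frobNorm D
      linarith
    rw [h1]
    have h4 := frobNorm_add_le (Pᵀ * P - 1) (Pᵀ * D + Dᵀ * Q)
    have h5 := frobNorm_add_le (Pᵀ * D) (Dᵀ * Q)
    linarith

end Perturbation

end CholQR

namespace CholQR

/-! ### Numerical constants of the two steps, residual, conclusion -/

section Main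

variable {m n : ℕ}

open scoped Matrix

theorem frobNorm_le_of_sq_le {p : ℕ} {A : Matrix (Fin m) (Fin n) ℝ} {S : Matrix (Fin p) (Fin n) ℝ}
    (h : frobNorm S ^ 2 ≤ 1.04 * frobNorm A ^ 2) : frobNorm S ≤ 1.02 * frobNorm A := by
  have hA := frobNorm_nonneg A
  refine le_of_sq_le_sq ?_ (by positivity)
  rw [mul_pow]
  norm_num at h ⊢
  have := sq_nonneg (frobNorm A)
  linarith

theorem gram_lower_bound {A : Matrix (Fin m) (Fin n) ℝ} {e : ℝ} (hE : frobNorm (Aᵀ * A - 1) ≤ e)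
    (x : Fin n → ℝ) : (1 - e) * (x ⬝ᵥ x) ≤ (A *ᵥ x) ⬝ᵥ (A *ᵥ x) := by
  have := (abs_le.1 (abs_mulVec_sub_self_le hE x)).1
  linarith

/-- The first step: a CholeskyQR step applied to a matrix that is not too ill-conditioned. -/
theorem FlCholeskyQR.first_step {X : Matrix (Fin m) (Fin n) ℝ} (hn : 0 < n) {σ : ℝ} (hσ : 0 < σ)
    (hσX : ∀ y : Fin n → ℝ, σ ^ 2 * (y ⬝ᵥ y) ≤ (X *ᵥ y) ⬝ᵥ (X *ᵥ y))
    (hσ2 : σ ≤ twoNorm X)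
    (hm : (m : ℝ) * u ≤ 1 / 64) (hnu : (n : ℝ) * (n + 1) * u ≤ 1 / 64)
    (hcond : 110.25 * ((m : ℝ) * u + ((n : ℝ) + 1) * u) * frobNorm X ^ 2 ≤ σ ^ 2)
    {out : Option (Matrix (Fin m) (Fin n) ℝ × Matrix (Fin n) (Fin n) ℝ)}
    (hout : FlCholeskyQR X out) :
    ∃ W Y, out = some (W, Y) ∧ frobNorm (Wᵀ * W - 1) ≤ 0.04 ∧ frobNorm W ≤ 1.018 * √n ∧
      frobNorm Y ≤ 1.02 * frobNorm X ∧ twoNorm Y ≤ 1.005 * twoNorm X ∧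
      frobNorm (W * Y - X) ≤ gam n * (frobNorm W * frobNorm Y) := by
  have hu := u_pos
  have hn1 : (1 : ℝ) ≤ n := by exact_mod_cast hn
  have hn1u : ((n + 1 : ℕ) : ℝ) * u ≤ 1 / 64 := by
    push_cast
    nlinarith [mul_nonneg (sub_nonneg.2 hn1) (mul_nonneg (by linarith : (0 : ℝ) ≤ n + 1) hu.le)]
  have hnu' : (n : ℝ) * u ≤ 1 / 64 := by
    push_cast at hn1u
    linarith
  have ha := gam_le hm
  have hb := gam_le hn1u
  have hg := gam_le hnu'
  have hF := frobNorm_nonneg X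
  have hσsq : 0 < σ ^ 2 := by positivity
  -- `1.04 * (64/63) / 110.25 < 0.0096`, where `110.25 = 10.5 ^ 2`.
  have he : 1.04 * (gam m + gam (n + 1)) * frobNorm X ^ 2 ≤ 0.0096 * σ ^ 2 := by
    push_cast at hb
    have h1 : gam m + gam (n + 1) ≤ 64 / 63 * ((m : ℝ) * u + ((n : ℝ) + 1) * u) := by linarith
    have h2 := mul_le_mul_of_nonneg_right h1 (sq_nonneg (frobNorm X))
    norm_num at hcond ⊢
    linarith
  obtain ⟨W, Y, rfl, hE, hY2, hWY⟩ := hout.exists_some hσX (by linarith) (by linarith)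
    (lt_of_le_of_lt he (by norm_num; linarith))
  have hE' := hE.trans he
  have hYF := frobNorm_le_of_sq_le hY2
  have hsqrt : 0.995 * σ ≤ √(σ ^ 2 - 0.0096 * σ ^ 2) := by
    refine Real.le_sqrt_of_sq_le ?_
    norm_num
    linarith
  have ht : gam n * frobNorm Y * √n ≤ 0.0125 * √(σ ^ 2 - 0.0096 * σ ^ 2) := by
    have h1 : gam n * frobNorm Y * √n ≤ 64 / 63 * (n * u) * (1.02 * frobNorm X) * √n := by
      have := gam_nonneg n
      have := frobNorm_nonneg Y
      gcongr
    have h2 : 64 / 63 * (n * u) * (1.02 * frobNorm X) * √n ≤ 0.0125 * (0.995 * σ) := by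
      refine le_of_sq_le_sq ?_ (by positivity)
      -- After squaring, one factor `u` goes with `n ^ 2`, which is controlled by `n (n+1) u ≤
      -- 1/64`, and the other with `n * frobNorm X ^ 2`, which is controlled by the condition
      -- number.
      have e1 : (64 / 63 * (n * u) * (1.02 * frobNorm X) * √(n : ℝ)) ^ 2
          = (64 / 63 * 1.02) ^ 2 * ((n * n * u) * (n * u * frobNorm X ^ 2)) := by
        simp only [mul_pow]
        rw [Real.sq_sqrt (Nat.cast_nonneg n)]
        ring
      have h3 : (n : ℝ) * n * u ≤ 1 / 64 := by nlinarith
      have h4 : n * u * frobNorm X ^ 2 ≤ σ ^ 2 / 110.25 := by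
        rw [le_div_iff₀ (by norm_num)]
        have h5 : 0 ≤ ((m : ℝ) * u + u) * frobNorm X ^ 2 := by positivity
        norm_num at hcond ⊢
        linarith
      have h5 : ((n : ℝ) * n * u) * (n * u * frobNorm X ^ 2) ≤ 1 / 64 * (σ ^ 2 / 110.25) :=
        mul_le_mul h3 h4 (by positivity) (by norm_num)
      rw [e1, mul_pow, mul_pow]
      norm_num at h5 ⊢
      linarith
    linarith
  obtain ⟨h1, h2, h3⟩ := cholQR_orthogonality (η := 0.0101) (C := 1.0051) (τ := 0.0125) (K := 1.018)
    (t := 0.0125) hn hσX hE' (by norm_num; linarith) hWY (by norm_num; linarith) (by norm_num)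
    (by norm_num) (by norm_num) ht le_rfl (by norm_num) (by norm_num)
  refine ⟨W, Y, rfl, h3.trans (by norm_num), h1, hYF, ?_, hWY⟩
  refine twoNorm_le (by have := twoNorm_nonneg X; positivity) fun x => ?_
  have h4 := (abs_le.1 (abs_mulVec_sub_mulVec_le hE' x)).2
  have h5 := dotProduct_mulVec_self_le X x
  have h6 : σ ^ 2 ≤ twoNorm X ^ 2 := pow_le_pow_left₀ hσ.le hσ2 2
  have h7 := mul_le_mul_of_nonneg_right h6 (dotProduct_self_nonneg_real x)
  have h8 := mul_nonneg (sq_nonneg (twoNorm X)) (dotProduct_self_nonneg_real x)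
  rw [mul_pow]
  norm_num at h4 ⊢
  linarith

/-- The second step: a CholeskyQR step applied to a nearly orthogonal matrix. -/
theorem FlCholeskyQR.second_step {W : Matrix (Fin m) (Fin n) ℝ} (hn : 0 < n)
    (hWorth : frobNorm (Wᵀ * W - 1) ≤ 0.04) (hWF : frobNorm W ≤ 1.018 * √n)
    (hmn : (m : ℝ) * n * u ≤ 1 / 64) (hnu : (n : ℝ) * (n + 1) * u ≤ 1 / 64)
    {out : Option (Matrix (Fin m) (Fin n) ℝ × Matrix (Fin n) (Fin n) ℝ)}
    (hout : FlCholeskyQR W out) :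
    ∃ Q Z, out = some (Q, Z) ∧
      frobNorm (Qᵀ * Q - 1) ≤ 5.9 * ((m : ℝ) * n * u + (n : ℝ) * (n + 1) * u) ∧
      frobNorm Q ≤ 1.037 * √n ∧ twoNorm Q ≤ 1.037 ∧ frobNorm Z ≤ 1.04 * √n ∧
      frobNorm (Q * Z - W) ≤ gam n * (frobNorm Q * frobNorm Z) := by
  have hu := u_pos
  have hn1 : (1 : ℝ) ≤ n := by exact_mod_cast hn
  have hmu : (m : ℝ) * u ≤ 1 / 64 := by
    nlinarith [mul_nonneg (sub_nonneg.2 hn1) (mul_nonneg (Nat.cast_nonneg (α := ℝ) m) hu.le)]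
  have hn1u : ((n + 1 : ℕ) : ℝ) * u ≤ 1 / 64 := by
    push_cast
    nlinarith [mul_nonneg (sub_nonneg.2 hn1) (mul_nonneg (by linarith : (0 : ℝ) ≤ n + 1) hu.le)]
  have hnu' : (n : ℝ) * u ≤ 1 / 64 := by
    push_cast at hn1u
    linarith
  have hn2 : (n : ℝ) * n * u ≤ (n : ℝ) * (n + 1) * u := by nlinarith
  have ha := gam_le hmu
  have hb := gam_le hn1u
  have hg := gam_le hnu'
  push_cast at hb hn1u
  set s : ℝ := (m : ℝ) * n * u + (n : ℝ) * (n + 1) * u with hs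
  have hs0 : 0 ≤ s := by positivity
  have hs1 : s ≤ 1 / 32 := by linarith
  have hW0 := frobNorm_nonneg W
  have hsn : √(n : ℝ) * √n = n := Real.mul_self_sqrt (Nat.cast_nonneg n)
  have hW2 : frobNorm W ^ 2 ≤ 1.0364 * n := by
    have := pow_le_pow_left₀ hW0 hWF 2
    rw [mul_pow, Real.sq_sqrt (Nat.cast_nonneg n)] at this
    norm_num at this ⊢
    linarith
  have he : 1.04 * (gam m + gam (n + 1)) * frobNorm W ^ 2 ≤ 1.1 * s := by
    have h1 : gam m + gam (n + 1) ≤ 64 / 63 * ((m : ℝ) * u + ((n : ℝ) + 1) * u) := by linarith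
    have h2 := mul_le_mul h1 hW2 (sq_nonneg _) (by positivity)
    have h3 : 64 / 63 * ((m : ℝ) * u + ((n : ℝ) + 1) * u) * (1.0364 * n)
        = 64 / 63 * 1.0364 * s := by rw [hs]; ring
    rw [h3] at h2
    norm_num at h2 ⊢
    linarith
  have hl := gram_lower_bound hWorth
  obtain ⟨Q, Z, rfl, hE, hZ2, hQZ⟩ := hout.exists_some hl (by linarith) (by linarith)
    (lt_of_le_of_lt he (by norm_num; linarith))
  have hE' := hE.trans he
  have hZF : frobNorm Z ≤ 1.04 * √n := by
    have h1 := frobNorm_le_of_sq_le hZ2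
    have := Real.sqrt_nonneg (n : ℝ)
    norm_num at h1 hWF ⊢
    linarith
  have hsqrt : 0.962 ≤ √(1 - 0.04 - 1.1 * s) := by
    refine Real.le_sqrt_of_sq_le ?_
    norm_num
    linarith
  have hnn0 : 0 ≤ (n : ℝ) * n * u := by positivity
  have ht : gam n * frobNorm Z * √n ≤ 1.1 * ((n : ℝ) * n * u) * √(1 - 0.04 - 1.1 * s) := by
    have h1 : gam n * frobNorm Z * √n ≤ 64 / 63 * (n * u) * (1.04 * √n) * √n := by
      have := gam_nonneg n
      have := frobNorm_nonneg Z
      gcongr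
    have h2 : 64 / 63 * (n * u) * (1.04 * √(n : ℝ)) * √n = 64 / 63 * 1.04 * ((n : ℝ) * n * u) := by
      linear_combination 64 / 63 * 1.04 * ((n : ℝ) * u) * hsn
    have h3 := mul_le_mul_of_nonneg_left hsqrt (mul_nonneg (by norm_num : (0 : ℝ) ≤ 1.1) hnn0)
    rw [h2] at h1
    norm_num at h1 h3 ⊢
    linarith
  -- As `s ≤ 1/32`, `l - e ≥ 0.96 - 1.1/32 > 0.925`, whence `η = 1.19 * s`; and `n ^ 2 * u ≤ 1/64`
  -- gives `τ = 0.0172 > 1.1/64`. Here `η` and `t` stay proportional to the rounding errors, so the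
  -- resulting defect does too.
  obtain ⟨h1, h2, h3⟩ := cholQR_orthogonality (η := 1.19 * s) (C := 1.019) (τ := 0.0172)
    (K := 1.037) (t := 1.1 * ((n : ℝ) * n * u)) hn hl hE' (by norm_num; linarith) hQZ
    (by norm_num; nlinarith) (by norm_num) (by norm_num; linarith) (by positivity) ht
    (by norm_num; linarith) (by norm_num) (by norm_num)
  refine ⟨Q, Z, rfl, h3.trans ?_, h1, h2, hZF, hQZ⟩
  have h4 : (n : ℝ) * n * u ≤ s := by
    have : 0 ≤ (m : ℝ) * n * u := by positivity
    linarith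
  norm_num
  linarith

theorem frobNorm_residual_le {X W Q : Matrix (Fin m) (Fin n) ℝ} {Y Z R : Matrix (Fin n) (Fin n) ℝ}
    (hWF : frobNorm W ≤ 1.018 * √n) (hYF : frobNorm Y ≤ 1.02 * frobNorm X)
    (hY : twoNorm Y ≤ 1.005 * twoNorm X)
    (hWY : frobNorm (W * Y - X) ≤ gam n * (frobNorm W * frobNorm Y))
    (hQF : frobNorm Q ≤ 1.037 * √n) (hQ : twoNorm Q ≤ 1.037) (hZF : frobNorm Z ≤ 1.04 * √n)
    (hQZ : frobNorm (Q * Z - W) ≤ gam n * (frobNorm Q * frobNorm Z))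
    (hR : FlMul Z Y R) (hnu : (n : ℝ) * u ≤ 1 / 64) :
    frobNorm (Q * R - X) ≤
      (2.52 * frobNorm X + 1.34 * √n * twoNorm X) * ((n : ℝ) * √n * u) := by
  have hu := u_pos
  have hg := gam_le hnu
  have hg0 := gam_nonneg n
  have hX0 := frobNorm_nonneg X
  have hX20 := twoNorm_nonneg X
  have hY0 := frobNorm_nonneg Y
  have hZ0 := frobNorm_nonneg Z
  have hQ0 := frobNorm_nonneg Q
  have hW0 := frobNorm_nonneg W
  have hR' := hR.frobNorm_sub_le
  have e : Q * R - X = Q * (R - Z * Y) + ((Q * Z - W) * Y + (W * Y - X)) := by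
    simp only [Matrix.mul_sub, Matrix.sub_mul, Matrix.mul_assoc]
    abel
  have h1 : frobNorm (Q * (R - Z * Y)) ≤
      1.037 * (64 / 63 * (n * u) * ((1.04 * √n) * (1.02 * frobNorm X))) := by
    refine (frobNorm_mul_le_twoNorm_left _ _).trans ?_
    refine mul_le_mul hQ (hR'.trans ?_) (frobNorm_nonneg _) (by norm_num)
    gcongr
  have h2 : frobNorm ((Q * Z - W) * Y) ≤
      64 / 63 * (n * u) * ((1.037 * √n) * (1.04 * √n)) * (1.005 * twoNorm X) := by
    refine (frobNorm_mul_le_twoNorm_right _ _).trans ?_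
    refine mul_le_mul (hQZ.trans ?_) hY (twoNorm_nonneg _) (by positivity)
    gcongr
  have h3 : frobNorm (W * Y - X) ≤
      64 / 63 * (n * u) * ((1.018 * √n) * (1.02 * frobNorm X)) := by
    refine hWY.trans ?_
    gcongr
  have h4 := frobNorm_add_le (Q * (R - Z * Y)) ((Q * Z - W) * Y + (W * Y - X))
  have h5 := frobNorm_add_le ((Q * Z - W) * Y) (W * Y - X)
  rw [← e] at h4
  have p1 : 0 ≤ n * u * √(n : ℝ) * frobNorm X := by positivity
  have p2 : 0 ≤ n * u * √(n : ℝ) * √n * twoNorm X := by positivity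
  norm_num at h1 h2 h3 ⊢
  linarith

/-- `‖X‖₂` cancels between `κ₂(X)` and `η`, leaving `10.5 c √(ε N) ≤ σ_n(X)`; square and use `‖X‖_F²
≤ c² N`. -/
theorem mul_frobNorm_sq_le_of_cond_le {X : Matrix (Fin m) (Fin n) ℝ} {v t₁ t₂ : ℕ}
    (hn : 0 < n) (hσ : 0 < sigmaMin X) (hT : IsT1 X v t₁ t₂) (hK : cond X ≤ K1 X v t₁ t₂) :
    110.25 * ((m : ℝ) * u + ((n : ℝ) + 1) * u) * frobNorm X ^ 2 ≤ sigmaMin X ^ 2 := by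
  have hu := u_pos
  have hX := hσ.trans_le (sigmaMin_le_twoNorm hn X)
  have hF := hT.frobNorm_sq_le
  set N : ℝ := (v : ℝ) * t₁ + (n : ℝ) * t₂ with hN
  set ε : ℝ := (m : ℝ) * u + ((n : ℝ) + 1) * u with hε
  have hN0 : 0 ≤ N := by positivity
  have hε0 : 0 ≤ ε := by positivity
  unfold cond K1 at hK
  rw [← hN, ← hε] at hK
  -- Were the denominator zero, `K1` would be `1 / 0 = 0`, which the positive condition number
  -- excludes.
  have hpos : 0 < 10.5 * eta X * √(ε * N) := by
    have : 0 < twoNorm X / sigmaMin X := div_pos hX hσ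
    exact one_div_pos.1 (this.trans_le hK)
  rw [div_le_div_iff₀ hσ hpos, one_mul] at hK
  have h1 : twoNorm X * (10.5 * eta X * √(ε * N)) = 10.5 * maxAbs X * √(ε * N) := by
    unfold eta
    field_simp
  rw [h1] at hK
  have hmax : 0 ≤ 10.5 * maxAbs X * √(ε * N) := by
    rw [← h1]; positivity
  have h2 := pow_le_pow_left₀ hmax hK 2
  rw [mul_pow, mul_pow, Real.sq_sqrt (by positivity)] at h2
  have h3 := mul_le_mul_of_nonneg_left hF hε0
  norm_num at h2 ⊢
  linarith

theorem IsT1.frobNorm_le {X : Matrix (Fin m) (Fin n) ℝ} {v t₁ t₂ : ℕ} (hT : IsT1 X v t₁ t₂)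
    (hX : 0 < twoNorm X) :
    frobNorm X ≤ eta X * √((v : ℝ) * t₁ + (n : ℝ) * t₂) * twoNorm X := by
  have h1 : eta X * √((v : ℝ) * t₁ + (n : ℝ) * t₂) * twoNorm X
      = maxAbs X * √((v : ℝ) * t₁ + (n : ℝ) * t₂) := by
    unfold eta
    field_simp
  have h2 : 0 ≤ maxAbs X := Real.iSup_nonneg fun p => abs_nonneg _
  rw [h1]
  refine le_of_sq_le_sq ?_ (by positivity)
  rw [mul_pow, Real.sq_sqrt (by positivity)]
  exact hT.frobNorm_sq_le

end Main

end CholQR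

theorem corollary4p1 {m n : ℕ} (hmn : n ≤ m) (X : Matrix (Fin m) (Fin n) ℝ)
    (hrank : X.rank = n) (v t₁ t₂ : ℕ) (hT : CholQR.IsT1 X v t₁ t₂)
    (h31 : (m : ℝ) * n * CholQR.u ≤ 1 / 64)
    (h32 : (n : ℝ) * (n + 1) * CholQR.u ≤ 1 / 64)
    (hK : CholQR.cond X ≤ CholQR.K1 X v t₁ t₂)
    (out : Option (Matrix (Fin m) (Fin n) ℝ × Matrix (Fin n) (Fin n) ℝ))
    (hout : CholQR.FlCholeskyQR2 X out) :
    ∃ (Q : Matrix (Fin m) (Fin n) ℝ) (R : Matrix (Fin n) (Fin n) ℝ), out = some (Q, R) ∧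
      CholQR.frobNorm (Q.transpose * Q - 1)
        ≤ 5.9 * ((m : ℝ) * n * CholQR.u + (n : ℝ) * (n + 1) * CholQR.u) ∧
      CholQR.frobNorm (Q * R - X)
        ≤ (2.52 * CholQR.eta X * √((v : ℝ) * t₁ + (n : ℝ) * t₂) + 1.34 * √(n : ℝ))
          * ((n : ℝ) * √(n : ℝ) * CholQR.u * CholQR.twoNorm X) := by
  open CholQR in
  -- The `v > 0` dense columns are among the `n` columns. Positivity of `n` makes the index `n - 1`
  -- in `sigmaMin` the genuine last one.
  have hn : 0 < n := by
    obtain ⟨hv, D, hD, -⟩ := hT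
    have := D.card_le_univ
    simp only [Fintype.card_fin] at this
    omega
  have hu := u_pos
  have hn1 : (1 : ℝ) ≤ n := by exact_mod_cast hn
  have hmu : (m : ℝ) * u ≤ 1 / 64 := by
    nlinarith [mul_nonneg (sub_nonneg.2 hn1) (mul_nonneg (Nat.cast_nonneg (α := ℝ) m) hu.le)]
  have hnu : (n : ℝ) * u ≤ 1 / 64 := by
    nlinarith [mul_nonneg (Nat.cast_nonneg (α := ℝ) n) (mul_nonneg (Nat.cast_nonneg (α := ℝ) n) hu.le)]
  have hσ := sigmaMin_pos hn hrank
  have hX := hσ.trans_le (sigmaMin_le_twoNorm hn X)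
  have first := fun {out} (h : FlCholeskyQR X out) =>
    h.first_step hn hσ (sigmaMin_sq_mul_le hn X) (sigmaMin_le_twoNorm hn X) hmu h32
      (mul_frobNorm_sq_le_of_cond_le hn hσ hT hK)
  cases hout with
  | breakdown₁ h =>
    obtain ⟨W, Y, h, -⟩ := first h
    cases h
  | breakdown₂ W Y h h' =>
    obtain ⟨W', Y', h, hW, hWF, -⟩ := first h
    cases h
    obtain ⟨Q, Z, h, -⟩ := h'.second_step hn hW hWF h31 h32
    cases h
  | done W Q Y Z R h h' hR =>
    obtain ⟨W', Y', h, hW, hWF, hYF, hY, hWY⟩ := first h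
    cases h
    obtain ⟨Q', Z', h, horth, hQF, hQ, hZF, hQZ⟩ := h'.second_step hn hW hWF h31 h32
    cases h
    refine ⟨Q, R, rfl, horth, ?_⟩
    refine (frobNorm_residual_le hWF hYF hY hWY hQF hQ hZF hQZ hR hnu).trans ?_
    have h1 := hT.frobNorm_le hX
    have h2 : 0 ≤ (n : ℝ) * √n * u := by positivity
    have h3 := mul_le_mul_of_nonneg_right h1 h2
    norm_num at h3 ⊢
    linarith
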